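/- **Gauge invariance of the dressed field.** Let $\mathfrak g$ be a Lie algebra of compact type, realized as a real space of hermitean $N\times N$ matrices closed under $i[\cdot,\cdot]$. Let $c^\mu$ be a real vector-valued distribution on $\mathbb R^{1,3}$ with $\partial_\mu c^\mu=\delta$, and let $I_c^\mu(v_\mu)(x)=\int d^4y\,c^\mu(y)\,v_\mu(x+y)$ denote string integration, defined on a space $V$ of smooth vector fields of sufficiently rapid decay with values in a space $S$ of smooth functions. Here "sufficiently rapid decay" means: $V$ contains all smooth compactly supported vector fields; components of elements of $V$ lie in $S$; $S\cdot S\subset S$, $S\cdot V\subset V$, $\partial S\subset V$, $\partial_\nu V\subset V$, $I_c(V)\subset S$; $S$ and $V$ are translation invariant; $c$ is linear on $V$ and may be differentiated along translations; and $\int c^\mu\partial_\mu f=-f(0)$ for $f\in S$. All fields are formal power series in the coupling constant $g$. A potential $A=(A_\mu)$ is a formal power series in $g$ of $\mathfrak g$-valued vector fields in $V$. Fields are functionals of $A$ with the pointwise (Wick) product. $\mathcal S^{\mathfrak g}$ is the smallest real space of such functionals that contains $I_c^\nu(\mathrm{ad}_{is_k}\cdots\mathrm{ad}_{is_1}(A_\nu))$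 ($k\ge0$) and $I_c^\nu(\mathrm{ad}_{is_k}\cdots\mathrm{ad}_{is_1}(\partial_\nu s_0))$ ($k\ge1$) whenever $s_0,\dots,s_k\in\mathcal S^{\mathfrak g}$, and $\mathcal V^{\mathfrak g}$ is the real span of the vector fields $\mathrm{ad}_{is_k}\cdots\mathrm{ad}_{is_1}(A_\nu)$ and $\mathrm{ad}_{is_k}\cdots\mathrm{ad}_{is_1}(\partial_\nu s_0)$ ($k\ge0$, $s_j\in\mathcal S^{\mathfrak g}$). Let $W=W[A,I_c]=e^{i\gamma}$ be the dressing factor: $\gamma\in g\,\mathcal S^{\mathfrak g}[[g]]$ is the solution, which exists and is unique, of $$I_c^\mu\big(W(gA_\mu+i\partial_\mu)W^{-1}\big)=0 .$$ A gauge function is $\theta=e^{ig\lambda}$, where $\lambda$ is a formal power series in $g$ of $\mathfrak g$-valued functions with entries in $S$; it acts by $A\mapsto A^\theta:=\theta^{-1}(A+ig^{-1}\partial)\theta$, which is again a potential, and on functionals by $X[A]\mapsto X[A^\theta]$. Then $$W[A^\theta,I_c](x)=W[A,I_c](x)\,\theta(x).$$ Consequently, $A^{W^{-1}}=W(A+ig^{-1}\partial)W^{-1}$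 is gauge invariant. Moreover, let $A_\mu(c)=I_c^\nu(\partial_\mu A_\nu-\partial_\nu A_\mu)$ and, for $\alpha\in g\,\mathcal V^{\mathfrak g}[[g]]$, let $\omega$ be the (tree-level obstruction) map of the mediator field $U^\mu=\langle F^{\mu\nu}|\alpha_\nu\rangle$, that is, the derivation of functionals of $A$ in the direction $\alpha[A]$, so that $\omega(A_\nu)=\alpha_\nu$. There is an $\alpha$ with $$e^{\omega}(A_\mu(c))=A^{W^{-1}}_\mu=W(A_\mu+ig^{-1}\partial_\mu)W^{-1},$$ and for every such $\alpha$ the dressed field $e^{\omega}(A_\mu(c))$ is gauge invariant: its values at $A^\theta$ and at $A$ coincide. -/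

import Mathlib

open scoped ContDiff

noncomputable section

/-! ### Spacetime and string integration -/

/-- Points of spacetime, in linear coordinates `x^0, …, x^3`. -/
abbrev Spacetime : Type := Fin 4 → ℝ

/-- The partial derivative `∂_μ f` of a real function. -/
def pd (μ : Fin 4) (f : Spacetime → ℝ) : Spacetime → ℝ :=
  fun x => fderiv ℝ f x (Pi.single μ 1)

/-- The gradient `(∂_μ f)_μ` of a real function. -/
def grad (f : Spacetime → ℝ) : Fin 4 → Spacetime → ℝ := fun μ => pd μ f

/-- The shiftField `y ↦ v (x + y)` of a real vector field. -/
def shiftField (x : Spacetime) (v : Fin 4 → Spacetime → ℝ) : Fin 4 → Spacetime → ℝ :=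
  fun μ y => v μ (x + y)

/-- A real vector-valued distribution `c^μ` on spacetime with `∂_μ c^μ = δ`, together with spaces
`S` of functions and `V` of vector fields that decay rapidly enough for string integration with `c`.
The number `c v` stands for `∫ d⁴y c^μ(y) v_μ(y)`; only its values on `V` matter.
How fast the elements of `S` and `V` have to decay depends on `c` (on its support, or on its own
decay) and is left open; for instance, if `c` is any distribution supported in a closed convex
cone `K` containing no line, one may take for `S` the smooth functions supported in some `B - K`
with `B` compact, and for `V` the vector fields with components in `S`. -/
structure StringDistribution where
  /-- scalar functions of sufficiently rapid decay -/
  S : Submodule ℝ (Spacetime → ℝ)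
  /-- vector fields of sufficiently rapid decay -/
  V : Submodule ℝ (Fin 4 → Spacetime → ℝ)
  /-- the pairing of the distribution with vector fields -/
  c : (Fin 4 → Spacetime → ℝ) → ℝ
  smooth : ∀ f ∈ S, ContDiff ℝ ∞ f
  component_mem : ∀ v ∈ V, ∀ μ, v μ ∈ S
  test_mem : ∀ v : Fin 4 → Spacetime → ℝ,
    (∀ μ, ContDiff ℝ ∞ (v μ) ∧ HasCompactSupport (v μ)) → v ∈ V
  mul_mem_S : ∀ f ∈ S, ∀ h ∈ S, f * h ∈ S
  mul_mem_V : ∀ f ∈ S, ∀ v ∈ V, (fun μ => f * v μ) ∈ V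
  grad_mem : ∀ f ∈ S, grad f ∈ V
  pd_mem : ∀ v ∈ V, ∀ ν, (fun μ => pd ν (v μ)) ∈ V
  translate_mem_S : ∀ f ∈ S, ∀ x, (fun y => f (x + y)) ∈ S
  translate_mem_V : ∀ v ∈ V, ∀ x, shiftField x v ∈ V
  c_add : ∀ v ∈ V, ∀ w ∈ V, c (v + w) = c v + c w
  c_smul : ∀ r : ℝ, ∀ v ∈ V, c (r • v) = r * c v
  /-- weak continuity along translations -/
  c_translate : ∀ v ∈ V, ∀ ν, HasDerivAt (fun t : ℝ => c (shiftField (Pi.single ν t) v))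
    (c (fun μ => pd ν (v μ))) 0
  /-- string integrals of rapidly decaying vector fields are admissible scalar functions -/
  string_mem : ∀ v ∈ V, (fun x => c (shiftField x v)) ∈ S
  /-- `∂_μ c^μ = δ` in the sense of distributions -/
  div_c : ∀ f ∈ S, c (grad f) = - f 0

/-- String integration `I_c^μ(v_μ)(x) = ∫ d⁴y c^μ(y) v_μ(x + y)`. -/
def StringDistribution.string (D : StringDistribution) (v : Fin 4 → Spacetime → ℝ) :
    Spacetime → ℝ :=
  fun x => D.c (shiftField x v)

/-! ### Matrix-valued functions and power series in the coupling constant -/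

/-- A Lie algebra of compact type, in a faithful unitary representation and in the physicists'
convention: a real space of hermitean matrices that is closed under `i[·,·]`. -/
def IsCompactLieAlgebra {n : Type} [Fintype n] (𝔤 : Submodule ℝ (Matrix n n ℂ)) : Prop :=
  (∀ X ∈ 𝔤, X.IsHermitian) ∧ ∀ X ∈ 𝔤, ∀ Y ∈ 𝔤, Complex.I • (X * Y - Y * X) ∈ 𝔤

/-- Matrix-valued functions on spacetime, with the pointwise product. -/
abbrev MatFun (n : Type) : Type := Spacetime → Matrix n n ℂ

/-- Formal power series in the coupling constant `g = PowerSeries.X`. -/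
abbrev MatSeries (n : Type) : Type := PowerSeries (MatFun n)

section

variable {n : Type} [Fintype n] [DecidableEq n]

/-- The real part of a matrix entry, as a function on spacetime. -/
def reEntry (i j : n) (f : MatFun n) : Spacetime → ℝ := fun x => (f x i j).re

/-- The imaginary part of a matrix entry, as a function on spacetime. -/
def imEntry (i j : n) (f : MatFun n) : Spacetime → ℝ := fun x => (f x i j).im

/-- `∂_μ` on matrix-valued functions. -/
def pdMat (μ : Fin 4) (f : MatFun n) : MatFun n :=
  fun x => Matrix.of fun i j => ⟨pd μ (reEntry i j f) x, pd μ (imEntry i j f) x⟩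

/-- `I_c^μ(v_μ)` for matrix-valued vector fields. -/
def stringMat (D : StringDistribution) (v : Fin 4 → MatFun n) : MatFun n :=
  fun x => Matrix.of fun i j =>
    ⟨D.string (fun μ => reEntry i j (v μ)) x, D.string (fun μ => imEntry i j (v μ)) x⟩

/-- `∂_μ` on power series, coefficient by coefficient. -/
def pdSeries (μ : Fin 4) (F : MatSeries n) : MatSeries n :=
  PowerSeries.mk fun m => pdMat μ (PowerSeries.coeff m F)

/-- `I_c^μ(v_μ)` on power series, coefficient by coefficient. -/
def stringSeries (D : StringDistribution) (v : Fin 4 → MatSeries n) : MatSeries n :=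
  PowerSeries.mk fun m => stringMat D fun μ => PowerSeries.coeff m (v μ)

/-- Division by the coupling constant: `g⁻¹ F`, for `F` without term of order `g^0`. -/
def divCoupling (F : MatSeries n) : MatSeries n :=
  PowerSeries.mk fun m => PowerSeries.coeff (m + 1) F

/-- `exp F = ∑ F^k / k!`, for `F` without term of order `g^0`
(so that only `k ≤ m` contributes to the order `g^m`). -/
def expSeries (F : MatSeries n) : MatSeries n :=
  PowerSeries.mk fun m =>
    ∑ k ∈ Finset.range (m + 1), ((k.factorial : ℂ)⁻¹) • PowerSeries.coeff m (F ^ k)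

/-- `𝔤`-valued scalar functions of sufficiently rapid decay. -/
def IsLieScalar (D : StringDistribution) (𝔤 : Submodule ℝ (Matrix n n ℂ)) (s : MatFun n) : Prop :=
  (∀ x, s x ∈ 𝔤) ∧ ∀ i j, reEntry i j s ∈ D.S ∧ imEntry i j s ∈ D.S

/-- `𝔤`-valued vector fields of sufficiently rapid decay. -/
def IsLieVector (D : StringDistribution) (𝔤 : Submodule ℝ (Matrix n n ℂ)) (v : Fin 4 → MatFun n) :
    Prop :=
  (∀ μ x, v μ x ∈ 𝔤) ∧
    ∀ i j, (fun μ => reEntry i j (v μ)) ∈ D.V ∧ (fun μ => imEntry i j (v μ)) ∈ D.V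

/-- Configurations of the gauge potential `A_μ` (off shell). Power series in `g` are admitted
because gauge transformations involve `g`. -/
def IsPotential (D : StringDistribution) (𝔤 : Submodule ℝ (Matrix n n ℂ))
    (A : Fin 4 → MatSeries n) : Prop :=
  ∀ m, IsLieVector D 𝔤 fun μ => PowerSeries.coeff m (A μ)

/-- Parameters `λ` of the gauge functions `θ = exp(i g λ)`. -/
def IsGaugeParameter (D : StringDistribution) (𝔤 : Submodule ℝ (Matrix n n ℂ))
    (l : MatSeries n) : Prop :=
  ∀ m, IsLieScalar D 𝔤 (PowerSeries.coeff m l)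

/-- The gauge function `θ = exp(i g λ)`. -/
def gaugeFunction (l : MatSeries n) : MatSeries n :=
  expSeries (Complex.I • (PowerSeries.X * l))

/-- The gauge transformation `A^θ = θ⁻¹ (A + i g⁻¹ ∂) θ`. -/
def gaugeTransform (θ : MatSeries n) (A : Fin 4 → MatSeries n) : Fin 4 → MatSeries n :=
  fun μ => Ring.inverse θ * A μ * θ + Complex.I • divCoupling (Ring.inverse θ * pdSeries μ θ)

end

/-! ### Fields as functionals of the gauge potential

Under the (commutative) Wick product, the fields generated by `A`, `∂` and `I_c` are functionals
`X[A]` of the potential, with the pointwise product. A gauge transformation acts on them by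
`X[A] ↦ X[A^θ]`. -/

/-- Scalar fields, as functionals of `A`. -/
abbrev ScalarField (n : Type) : Type := (Fin 4 → MatSeries n) → MatSeries n

/-- Vector fields, as functionals of `A`. -/
abbrev VectorField (n : Type) : Type := (Fin 4 → MatSeries n) → Fin 4 → MatSeries n

section

variable {n : Type} [Fintype n] [DecidableEq n]

/-- `ad_{is}(v)_μ = i[s, v_μ]`. -/
def adField (s : ScalarField n) (v : VectorField n) : VectorField n :=
  fun A μ => Complex.I • (s A * v A μ - v A μ * s A)

/-- `ad_{i s_k} ⋯ ad_{i s_1}(v)` for the list `[s_k, …, s_1]`. -/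
def adChain (l : List (ScalarField n)) (v : VectorField n) : VectorField n :=
  l.foldr adField v

/-- The field `∂_μ s`. -/
def gradField (s : ScalarField n) : VectorField n := fun A μ => pdSeries μ (s A)

/-- The field `I_c^μ(v_μ)`. -/
def stringField (D : StringDistribution) (v : VectorField n) : ScalarField n :=
  fun A => stringSeries D (v A)

/-- The field `A_μ` itself. -/
def potentialField : VectorField n := fun A => A

/-- The smallest real space `𝒮^𝔤` of scalar fields that contains
`I_c^ν(ad_{i s_k} ⋯ ad_{i s_1}(A_ν))` for `k ≥ 0` and
`I_c^ν(ad_{i s_k} ⋯ ad_{i s_1}(∂_ν s_0))` for `k ≥ 1`, whenever all `s_j` belong to it. -/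
inductive InS (D : StringDistribution) : ScalarField n → Prop
  | zero : InS D 0
  | add (s t : ScalarField n) : InS D s → InS D t → InS D (s + t)
  | smul (r : ℝ) (s : ScalarField n) : InS D s → InS D (r • s)
  | string_A (l : List (ScalarField n)) : (∀ s ∈ l, InS D s) →
      InS D (stringField D (adChain l potentialField))
  | string_grad (l : List (ScalarField n)) (s₀ : ScalarField n) : l ≠ [] → (∀ s ∈ l, InS D s) →
      InS D s₀ → InS D (stringField D (adChain l (gradField s₀)))

/-- The smallest real space `𝒱^𝔤` of vector fields that contains
`ad_{i s_k} ⋯ ad_{i s_1}(A_ν)` and `ad_{i s_k} ⋯ ad_{i s_1}(∂_ν s_0)` for `k ≥ 0` and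
`s_j ∈ 𝒮^𝔤`. -/
inductive InV (D : StringDistribution) : VectorField n → Prop
  | zero : InV D 0
  | add (v w : VectorField n) : InV D v → InV D w → InV D (v + w)
  | smul (r : ℝ) (v : VectorField n) : InV D v → InV D (r • v)
  | ad_A (l : List (ScalarField n)) : (∀ s ∈ l, InS D s) → InV D (adChain l potentialField)
  | ad_grad (l : List (ScalarField n)) (s₀ : ScalarField n) : (∀ s ∈ l, InS D s) →
      InS D s₀ → InV D (adChain l (gradField s₀))

/-- The power series `∑_k g^k F_k`, where the `F_k` may themselves depend on `g`. -/
def sumSeries (F : ℕ → MatSeries n) : MatSeries n :=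
  PowerSeries.mk fun m => ∑ p ∈ Finset.HasAntidiagonal.antidiagonal m, PowerSeries.coeff p.2 (F p.1)

/-- Membership in `g 𝒮^𝔤[[g]]`, for functionals of admissible potentials. -/
def InGSeriesS (D : StringDistribution) (𝔤 : Submodule ℝ (Matrix n n ℂ)) (γ : ScalarField n) :
    Prop :=
  ∃ a : ℕ → ScalarField n, (∀ k, InS D (a k)) ∧ a 0 = 0 ∧
    ∀ A, IsPotential D 𝔤 A → γ A = sumSeries fun k => a k A

/-- Membership in `g 𝒱^𝔤[[g]]`, for functionals of admissible potentials. -/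
def InGSeriesV (D : StringDistribution) (𝔤 : Submodule ℝ (Matrix n n ℂ)) (α : VectorField n) :
    Prop :=
  ∃ a : ℕ → VectorField n, (∀ k, InV D (a k)) ∧ a 0 = 0 ∧
    ∀ A, IsPotential D 𝔤 A → ∀ μ, α A μ = sumSeries fun k => a k A μ

/-- `W = exp(iγ)`. -/
def dressingFactor (γ : ScalarField n) : ScalarField n :=
  fun A => expSeries (Complex.I • γ A)

/-- `γ ∈ g 𝒮^𝔤[[g]]` and `W = exp(iγ)` satisfies `I_c^μ(W (g A_μ + i ∂_μ) W⁻¹) = 0`. -/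
def IsDressingExponent (D : StringDistribution) (𝔤 : Submodule ℝ (Matrix n n ℂ))
    (γ : ScalarField n) : Prop :=
  InGSeriesS D 𝔤 γ ∧ ∀ A, IsPotential D 𝔤 A →
    stringSeries D (fun μ =>
      dressingFactor γ A * (PowerSeries.X * A μ) * Ring.inverse (dressingFactor γ A) +
        Complex.I • (dressingFactor γ A * pdSeries μ (Ring.inverse (dressingFactor γ A)))) = 0

/-- The operator-valued gauge transform `A^{W⁻¹} = W (A + i g⁻¹ ∂) W⁻¹`. -/
def dressedPotential (γ : ScalarField n) : VectorField n :=
  fun A => gaugeTransform (Ring.inverse (dressingFactor γ A)) A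

/-- The field strength `F_{μν} = ∂_μ A_ν - ∂_ν A_μ` of the free theory. -/
def fieldStrength (A : Fin 4 → MatSeries n) (μ ν : Fin 4) : MatSeries n :=
  pdSeries μ (A ν) - pdSeries ν (A μ)

/-- The string-localized potential `A_μ(c) = I_c^ν(F_{μν})`. -/
def stringPotential (D : StringDistribution) : VectorField n :=
  fun A μ => stringSeries D (fieldStrength A μ)

/-- The obstruction map `ω_U` of the mediator field `U^μ = ⟨F^{μν} | α_ν⟩`, at tree level.
The two-point obstruction of `F^{μν}` and `A^κ` is `i O_μ(F^{μν}(x'), A^κ(x)) = η^{νκ} δ(x' - x)`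
and `α_ν` is inert, so that `ω_U` is the derivation `∫ dx' ⟨α_ν(x') | δ/δA_ν(x')⟩`
with `ω_U(A_ν) = α_ν`: the derivative of functionals of `A` in the direction `α[A]`. -/
def obstruction (α : VectorField n) (X : VectorField n) : VectorField n :=
  fun A μ => PowerSeries.mk fun m x => Matrix.of fun i j =>
    deriv (fun ε : ℝ => PowerSeries.coeff m (X (A + ε • α A) μ) x i j) 0

/-- The flow `e^{ω_U} = ∑ ω_U^k / k!`, for `α` without term of order `g^0`
(so that only `k ≤ m` contributes to the order `g^m`). -/
def expObstruction (α : VectorField n) (X : VectorField n) : VectorField n :=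
  fun A μ => PowerSeries.mk fun m =>
    ∑ k ∈ Finset.range (m + 1),
      ((k.factorial : ℂ)⁻¹) • PowerSeries.coeff m ((obstruction α)^[k] X A μ)

/-- `U^μ = ⟨F^{μν} | α_ν⟩` with `α ∈ g 𝒱^𝔤[[g]]` generates the dressing transformation
`e^{ω_U}(A_μ(c)) = W (A_μ + i g⁻¹ ∂_μ) W⁻¹`. -/
def GeneratesDressing (D : StringDistribution) (𝔤 : Submodule ℝ (Matrix n n ℂ))
    (γ : ScalarField n) (α : VectorField n) : Prop :=
  InGSeriesV D 𝔤 α ∧ ∀ A, IsPotential D 𝔤 A →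
    expObstruction α (stringPotential D) A = dressedPotential γ A

end

end

open scoped ContDiff

noncomputable section

set_option linter.unusedSectionVars false

/-! ### Calculus of matrix-valued functions -/

section MatrixCalculus

variable {n : Type}

/-! Gauge covariance is a consequence of uniqueness. Put B = W(gA + i∂)W⁻¹ (`dressedForm`).
Replacing A by A^θ and W by Wθ leaves B unchanged (`dressedForm_gaugeTransform`), so Wθ solves the
dressing equation at A^θ. If W and W' solve the equation at the same A, then U = W'W⁻¹ satisfies B'U
= UB - i∂U. In the lowest order g^m in which U could differ from 1 this reads B'_m = B_m - i∂U_m,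
and string integration, with I_c(∂f) = -f, gives U_m = 0 (`eq_one_of_intertwines`,
`dressing_unique`). This argument lives among series 1 + O(g) with higher coefficients having
entries in S, so Wθ need not be exhibited as e^{iγ} with γ from 𝒮^𝔤. Hence W[A^θ] = W[A]θ, and
A^{W⁻¹} = g⁻¹B is invariant.

Existence: for γ = gG, expanding e^u v e^{-u} and e^u ∂e^{-u} in commutators gives A^{W⁻¹} = ∑_{k≥0}
ad^k(A)/k! + ∑_{k≥0} ad^k(∂G)/(k+1)! with ad = ad_{igG} (`gaugeTransform_expSeries_neg`). Take G =
I_c(Φ), where Φ consists of all these terms except ∂G, the k = 0 term of the second sum. Then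
A^{W⁻¹} = Φ + ∂I_c(Φ), which I_c annihilates. Since every ad carries a factor g, this requirement on
Φ is a recursion on orders (`exists_dressingSeq`, `adExp_dressingSeq`).

Generator: A_μ(c) = A_μ + ∂_μ I_c(A) is the image of A under the same linear map 1 + ∂I_c, and this
map commutes with ω. It therefore suffices that e^ω(A) = Φ. In order g^{l+1} the term ω(A) is the
new coefficient of α, while ω^k(A)/k! with k ≥ 2 involves only earlier coefficients
(`exists_generatorSeq`, `sum_generatorSeq`).

All coefficients are values of finite expressions (`FieldExpr`). The syntax gives membership in 𝒮^𝔤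
and 𝒱^𝔤 by induction, and since the values are polynomial in A, derivatives along α need no
continuity of c. -/

/-- Matrix-valued functions with smooth entries. -/
def SmoothMat (f : MatFun n) : Prop := ∀ i j, ContDiff ℝ ∞ (fun x => f x i j)

lemma SmoothMat.differentiableAt {f : MatFun n} (hf : SmoothMat f) (i j : n) (x : Spacetime) :
    DifferentiableAt ℝ (fun x => f x i j) x :=
  ((hf i j).differentiable (by simp)).differentiableAt

/-- Real and imaginary parts are continuous linear and commute with the derivative. This passes from
the real definition of `pdMat` to complex entries, where the product rule is available. -/
lemma pdMat_apply {f : MatFun n} (hf : SmoothMat f) (μ : Fin 4) (x : Spacetime) (i j : n) :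
    pdMat μ f x i j = fderiv ℝ (fun y => f y i j) x (Pi.single μ 1) := by
  have h := (hf.differentiableAt i j x).hasFDerivAt
  have hre := Complex.reCLM.hasFDerivAt.comp x h
  have him := Complex.imCLM.hasFDerivAt.comp x h
  apply Complex.ext
  · change fderiv ℝ (Complex.reCLM ∘ fun y => f y i j) x _ = _
    rw [hre.fderiv]; rfl
  · change fderiv ℝ (Complex.imCLM ∘ fun y => f y i j) x _ = _
    rw [him.fderiv]; rfl

lemma smoothMat_of_entries {f : MatFun n} (hre : ∀ i j, ContDiff ℝ ∞ (reEntry i j f))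
    (him : ∀ i j, ContDiff ℝ ∞ (imEntry i j f)) : SmoothMat f := by
  intro i j
  have : (fun x => f x i j) =
      fun x => Complex.ofRealCLM (reEntry i j f x) + Complex.ofRealCLM (imEntry i j f x) * Complex.I := by
    funext x; exact (Complex.re_add_im _).symm
  rw [this]
  exact (Complex.ofRealCLM.contDiff.comp (hre i j)).add
    ((Complex.ofRealCLM.contDiff.comp (him i j)).mul contDiff_const)

lemma SmoothMat.zero : SmoothMat (0 : MatFun n) := fun _ _ => contDiff_const

lemma SmoothMat.add {f h : MatFun n} (hf : SmoothMat f) (hh : SmoothMat h) :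
    SmoothMat (f + h) := fun i j => (hf i j).add (hh i j)

lemma SmoothMat.smul {f : MatFun n} (a : ℂ) (hf : SmoothMat f) : SmoothMat (a • f) :=
  fun i j => contDiff_const.mul (hf i j)

lemma SmoothMat.one [DecidableEq n] : SmoothMat (1 : MatFun n) := fun _ _ => contDiff_const

lemma SmoothMat.mul [Fintype n] {f h : MatFun n} (hf : SmoothMat f) (hh : SmoothMat h) :
    SmoothMat (f * h) := fun i j => by
  simp only [Pi.mul_apply, Matrix.mul_apply]
  exact ContDiff.sum fun k _ => (hf i k).mul (hh k j)

lemma SmoothMat.pdMat {f : MatFun n} (hf : SmoothMat f) (μ : Fin 4) : SmoothMat (pdMat μ f) := by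
  intro i j
  simp only [pdMat_apply hf]
  exact ((hf i j).fderiv_right (m := ∞) (by simp)).clm_apply contDiff_const

lemma pdMat_add {f h : MatFun n} (hf : SmoothMat f) (hh : SmoothMat h) (μ : Fin 4) :
    pdMat μ (f + h) = pdMat μ f + pdMat μ h := by
  funext x; ext i j
  rw [pdMat_apply (hf.add hh)]
  simp only [Pi.add_apply, Matrix.add_apply]
  rw [pdMat_apply hf, pdMat_apply hh,
    fderiv_fun_add (hf.differentiableAt i j x) (hh.differentiableAt i j x)]
  rfl

lemma pdMat_smul {f : MatFun n} (a : ℂ) (hf : SmoothMat f) (μ : Fin 4) :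
    pdMat μ (a • f) = a • pdMat μ f := by
  funext x; ext i j
  rw [pdMat_apply (hf.smul a)]
  simp only [Pi.smul_apply, Matrix.smul_apply]
  rw [pdMat_apply hf, fderiv_fun_const_smul (hf.differentiableAt i j x)]
  rfl

lemma pdMat_one [DecidableEq n] (μ : Fin 4) : pdMat μ (1 : MatFun n) = 0 := by
  funext x; ext i j
  rw [pdMat_apply SmoothMat.one]
  simp

lemma pdMat_zero (μ : Fin 4) : pdMat μ (0 : MatFun n) = 0 := by
  funext x; ext i j
  rw [pdMat_apply SmoothMat.zero]
  simp

lemma pdMat_mul [Fintype n] {f h : MatFun n} (hf : SmoothMat f) (hh : SmoothMat h) (μ : Fin 4) :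
    pdMat μ (f * h) = pdMat μ f * h + f * pdMat μ h := by
  funext x; ext i j
  rw [pdMat_apply (hf.mul hh)]
  simp only [Pi.add_apply, Pi.mul_apply, Matrix.add_apply, Matrix.mul_apply]
  rw [fderiv_fun_sum fun k _ => (hf.differentiableAt i k x).fun_mul (hh.differentiableAt k j x),
    sum_apply, ← Finset.sum_add_distrib]
  refine Finset.sum_congr rfl fun k _ => ?_
  rw [fderiv_fun_mul (hf.differentiableAt i k x) (hh.differentiableAt k j x), pdMat_apply hf,
    pdMat_apply hh]
  simp only [add_apply, smul_apply, smul_eq_mul]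
  ring

end MatrixCalculus

/-! ### Real functions and string integration -/

lemma hasFDerivAt_of_mem (D : StringDistribution) {f : Spacetime → ℝ} (hf : f ∈ D.S)
    (x : Spacetime) : HasFDerivAt f (fderiv ℝ f x) x :=
  (((D.smooth f hf).differentiable (by simp)).differentiableAt).hasFDerivAt

lemma pd_translate (μ : Fin 4) (f : Spacetime → ℝ) (x : Spacetime) :
    pd μ (fun y => f (x + y)) = fun y => pd μ f (x + y) := by
  funext y
  simp only [pd, fderiv_comp_add_left]

namespace StringDistribution

variable (D : StringDistribution)

lemma string_add {v w : Fin 4 → Spacetime → ℝ} (hv : v ∈ D.V) (hw : w ∈ D.V) :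
    D.string (v + w) = D.string v + D.string w := by
  funext x
  exact D.c_add _ (D.translate_mem_V v hv x) _ (D.translate_mem_V w hw x)

lemma string_smul (r : ℝ) {v : Fin 4 → Spacetime → ℝ} (hv : v ∈ D.V) :
    D.string (r • v) = r • D.string v := by
  funext x
  exact D.c_smul r _ (D.translate_mem_V v hv x)

/-- This is `∂_μ c^μ = δ` tested on the translate f(x + ·); it makes -I_c a left inverse of the
gradient, the fact behind both uniqueness and existence. -/
lemma string_grad {f : Spacetime → ℝ} (hf : f ∈ D.S) : D.string (grad f) = -f := by
  funext x
  have h := D.div_c _ (D.translate_mem_S f hf x)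
  have e : shiftField x (grad f) = grad fun y => f (x + y) := by
    funext μ y
    simp only [shiftField, grad, pd_translate]
  simp only [string, e, h, add_zero, Pi.neg_apply]

/-- The derivative at t = 0 of t ↦ I_c(v)(x + t e_μ) is computed twice: by the chain rule, since
string integrals lie in S and are smooth, and by `c_translate` for v shifted by x. -/
lemma pd_string {v : Fin 4 → Spacetime → ℝ} (hv : v ∈ D.V) (μ : Fin 4) :
    pd μ (D.string v) = D.string fun ν => pd μ (v ν) := by
  funext x
  have h1 := hasFDerivAt_of_mem D (D.string_mem v hv) x
  have hl : HasDerivAt (fun t : ℝ => x + Pi.single μ t) (Pi.single μ (1 : ℝ)) 0 := by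
    have := ((hasDerivAt_id (0 : ℝ)).smul_const (Pi.single μ (1 : ℝ) : Spacetime)).const_add x
    simpa [← Pi.single_smul] using this
  have h1' : HasFDerivAt (fun x => D.c (shiftField x v))
      (fderiv ℝ (fun x => D.c (shiftField x v)) x) (x + Pi.single μ (0 : ℝ)) := by simpa using h1
  have h2 := h1'.comp_hasDerivAt (0 : ℝ) hl
  have h3 := D.c_translate _ (D.translate_mem_V v hv x) μ
  have e1 : ((fun x => D.c (shiftField x v)) ∘ fun t : ℝ => x + Pi.single μ t) =
      fun t : ℝ => D.c (shiftField (Pi.single μ t) (shiftField x v)) := by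
    funext t
    refine congrArg D.c ?_
    funext ν y
    simp only [shiftField, add_assoc]
  have e2 : (fun ν => pd μ (shiftField x v ν)) = shiftField x fun ν => pd μ (v ν) := by
    funext ν
    exact pd_translate μ (v ν) x
  rw [e1] at h2
  rw [e2] at h3
  exact h2.unique h3

end StringDistribution

/-! ### Matrix-valued functions of rapid decay -/

section Rapid

variable {n : Type} (D : StringDistribution)

/-- Matrix-valued functions whose entries decay rapidly. -/
def rapidMat (n : Type) : Submodule ℂ (MatFun n) where
  carrier := {s | ∀ i j, reEntry i j s ∈ D.S ∧ imEntry i j s ∈ D.S}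
  zero_mem' _ _ := ⟨D.S.zero_mem, D.S.zero_mem⟩
  add_mem' hs ht i j := ⟨D.S.add_mem (hs i j).1 (ht i j).1, D.S.add_mem (hs i j).2 (ht i j).2⟩
  smul_mem' a _ hs i j :=
    ⟨D.S.sub_mem (D.S.smul_mem a.re (hs i j).1) (D.S.smul_mem a.im (hs i j).2),
      D.S.add_mem (D.S.smul_mem a.re (hs i j).2) (D.S.smul_mem a.im (hs i j).1)⟩

/-- Matrix-valued vector fields whose entries decay rapidly. -/
def rapidVec (n : Type) : Submodule ℂ (Fin 4 → MatFun n) where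
  carrier := {v | ∀ i j, (fun μ => reEntry i j (v μ)) ∈ D.V ∧ (fun μ => imEntry i j (v μ)) ∈ D.V}
  zero_mem' _ _ := ⟨D.V.zero_mem, D.V.zero_mem⟩
  add_mem' hs ht i j := ⟨D.V.add_mem (hs i j).1 (ht i j).1, D.V.add_mem (hs i j).2 (ht i j).2⟩
  smul_mem' a _ hs i j :=
    ⟨D.V.sub_mem (D.V.smul_mem a.re (hs i j).1) (D.V.smul_mem a.im (hs i j).2),
      D.V.add_mem (D.V.smul_mem a.re (hs i j).2) (D.V.smul_mem a.im (hs i j).1)⟩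

variable {D}

lemma smoothMat_of_rapid {s : MatFun n} (hs : s ∈ rapidMat D n) : SmoothMat s :=
  smoothMat_of_entries (fun i j => D.smooth _ (hs i j).1) fun i j => D.smooth _ (hs i j).2

lemma rapidVec_component {v : Fin 4 → MatFun n} (hv : v ∈ rapidVec D n) (μ : Fin 4) :
    v μ ∈ rapidMat D n := fun i j =>
  ⟨D.component_mem _ (hv i j).1 μ, D.component_mem _ (hv i j).2 μ⟩

section

variable [Fintype n]

lemma reEntry_mul (f h : MatFun n) (i j : n) : reEntry i j (f * h) =
    ∑ k, (reEntry i k f * reEntry k j h - imEntry i k f * imEntry k j h) := by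
  funext x
  simp [reEntry, imEntry, Matrix.mul_apply, Finset.sum_apply]

lemma imEntry_mul (f h : MatFun n) (i j : n) : imEntry i j (f * h) =
    ∑ k, (reEntry i k f * imEntry k j h + imEntry i k f * reEntry k j h) := by
  funext x
  simp [reEntry, imEntry, Matrix.mul_apply, Finset.sum_apply]

lemma rapidMat_mul {s t : MatFun n} (hs : s ∈ rapidMat D n) (ht : t ∈ rapidMat D n) :
    s * t ∈ rapidMat D n := by
  intro i j
  rw [reEntry_mul, imEntry_mul]
  exact ⟨D.S.sum_mem fun k _ => D.S.sub_mem (D.mul_mem_S _ (hs i k).1 _ (ht k j).1)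
      (D.mul_mem_S _ (hs i k).2 _ (ht k j).2),
    D.S.sum_mem fun k _ => D.S.add_mem (D.mul_mem_S _ (hs i k).1 _ (ht k j).2)
      (D.mul_mem_S _ (hs i k).2 _ (ht k j).1)⟩

lemma rapidVec_mul_left {s : MatFun n} {v : Fin 4 → MatFun n} (hs : s ∈ rapidMat D n)
    (hv : v ∈ rapidVec D n) : (fun μ => s * v μ) ∈ rapidVec D n := by
  intro i j
  simp only [reEntry_mul, imEntry_mul]
  constructor
  · convert D.V.sum_mem fun (k : n) (_ : k ∈ Finset.univ) =>
      D.V.sub_mem (D.mul_mem_V _ (hs i k).1 _ (hv k j).1) (D.mul_mem_V _ (hs i k).2 _ (hv k j).2)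
    simp [Finset.sum_apply]
  · convert D.V.sum_mem fun (k : n) (_ : k ∈ Finset.univ) =>
      D.V.add_mem (D.mul_mem_V _ (hs i k).1 _ (hv k j).2) (D.mul_mem_V _ (hs i k).2 _ (hv k j).1)
    simp [Finset.sum_apply]

lemma rapidVec_mul_right {s : MatFun n} {v : Fin 4 → MatFun n} (hs : s ∈ rapidMat D n)
    (hv : v ∈ rapidVec D n) : (fun μ => v μ * s) ∈ rapidVec D n := by
  intro i j
  simp only [reEntry_mul, imEntry_mul, mul_comm (reEntry i _ (v _)), mul_comm (imEntry i _ (v _))]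
  constructor
  · convert D.V.sum_mem fun (k : n) (_ : k ∈ Finset.univ) =>
      D.V.sub_mem (D.mul_mem_V _ (hs k j).1 _ (hv i k).1) (D.mul_mem_V _ (hs k j).2 _ (hv i k).2)
    simp [Finset.sum_apply]
  · convert D.V.sum_mem fun (k : n) (_ : k ∈ Finset.univ) =>
      D.V.add_mem (D.mul_mem_V _ (hs k j).2 _ (hv i k).1) (D.mul_mem_V _ (hs k j).1 _ (hv i k).2)
    simp [Finset.sum_apply]

end

lemma rapidVec_grad {s : MatFun n} (hs : s ∈ rapidMat D n) :
    (fun μ => pdMat μ s) ∈ rapidVec D n := fun i j =>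
  ⟨D.grad_mem _ (hs i j).1, D.grad_mem _ (hs i j).2⟩

lemma rapidVec_pd {v : Fin 4 → MatFun n} (hv : v ∈ rapidVec D n) (ν : Fin 4) :
    (fun μ => pdMat ν (v μ)) ∈ rapidVec D n := fun i j =>
  ⟨D.pd_mem _ (hv i j).1 ν, D.pd_mem _ (hv i j).2 ν⟩

lemma rapidMat_string {v : Fin 4 → MatFun n} (hv : v ∈ rapidVec D n) :
    stringMat D v ∈ rapidMat D n := fun i j =>
  ⟨D.string_mem _ (hv i j).1, D.string_mem _ (hv i j).2⟩

lemma stringMat_add {v w : Fin 4 → MatFun n} (hv : v ∈ rapidVec D n) (hw : w ∈ rapidVec D n) :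
    stringMat D (v + w) = stringMat D v + stringMat D w := by
  funext x; ext i j
  exact Complex.ext (congrFun (D.string_add (hv i j).1 (hw i j).1) x)
    (congrFun (D.string_add (hv i j).2 (hw i j).2) x)

lemma stringMat_smul (a : ℂ) {v : Fin 4 → MatFun n} (hv : v ∈ rapidVec D n) :
    stringMat D (a • v) = a • stringMat D v := by
  funext x; ext i j
  have h1 := D.V.smul_mem a.re (hv i j).1
  have h2 := D.V.smul_mem a.im (hv i j).2
  have h3 := D.V.smul_mem a.re (hv i j).2
  have h4 := D.V.smul_mem a.im (hv i j).1
  apply Complex.ext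
  · have := D.string_add h1 (D.V.neg_mem h2)
    rw [← neg_smul, D.string_smul _ (hv i j).1, D.string_smul _ (hv i j).2] at this
    have h := congrFun this x
    simp only [Pi.add_apply, Pi.smul_apply, smul_eq_mul, neg_mul, ← sub_eq_add_neg] at h
    simp only [Pi.smul_apply, Matrix.smul_apply, smul_eq_mul, Complex.mul_re]
    refine Eq.trans ?_ h
    refine congrFun (congrArg D.string ?_) x
    funext μ y
    simp [reEntry, imEntry, sub_eq_add_neg]
  · have := D.string_add h3 h4
    rw [D.string_smul _ (hv i j).1, D.string_smul _ (hv i j).2] at this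
    have h := congrFun this x
    exact h

lemma stringMat_zero : stringMat D (0 : Fin 4 → MatFun n) = 0 := by
  have := stringMat_smul 0 (rapidVec D n).zero_mem
  simpa using this

lemma stringMat_grad {s : MatFun n} (hs : s ∈ rapidMat D n) :
    stringMat D (fun μ => pdMat μ s) = -s := by
  funext x; ext i j
  exact Complex.ext (congrFun (D.string_grad (hs i j).1) x) (congrFun (D.string_grad (hs i j).2) x)

lemma pdMat_stringMat {v : Fin 4 → MatFun n} (hv : v ∈ rapidVec D n) (μ : Fin 4) :
    pdMat μ (stringMat D v) = stringMat D fun ν => pdMat μ (v ν) := by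
  funext x; ext i j
  exact Complex.ext (congrFun (D.pd_string (hv i j).1 μ) x)
    (congrFun (D.pd_string (hv i j).2 μ) x)

end Rapid

/-! ### Fields with values in the Lie algebra -/

section LieValued

variable {n : Type} [Fintype n] [DecidableEq n]

/-- The real linear functional on matrices with given coefficients. -/
def matFunctional (a b : n → n → ℝ) (Q : Matrix n n ℂ) : ℝ :=
  ∑ i, ∑ j, (a i j * (Q i j).re + b i j * (Q i j).im)

/-- A point outside a subspace is separated from it by a linear functional, and every real
functional on matrices has the form `matFunctional`. Derivatives and string integrals are defined
entrywise, so this is how they are seen to stay in 𝔤. -/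
lemma mem_of_functionals (𝔤 : Submodule ℝ (Matrix n n ℂ)) (Q : Matrix n n ℂ)
    (h : ∀ a b : n → n → ℝ, (∀ Y ∈ 𝔤, matFunctional a b Y = 0) → matFunctional a b Q = 0) :
    Q ∈ 𝔤 := by
  by_contra hQ
  obtain ⟨f, hf, hker⟩ := Submodule.exists_le_ker_of_notMem hQ
  have key : ∀ Y : Matrix n n ℂ, f Y = matFunctional (fun i j => f (Matrix.single i j 1))
      (fun i j => f (Matrix.single i j Complex.I)) Y := by
    intro Y
    have hY : Y = ∑ i, ∑ j, ((Y i j).re • Matrix.single i j (1 : ℂ) +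
        (Y i j).im • Matrix.single i j Complex.I) := by
      conv_lhs => rw [Matrix.matrix_eq_sum_single Y]
      refine Finset.sum_congr rfl fun i _ => Finset.sum_congr rfl fun j _ => ?_
      rw [Matrix.smul_single, Matrix.smul_single, ← Matrix.single_add]
      congr 1
      simp
    conv_lhs => rw [hY]
    simp only [map_sum, map_add, map_smul, smul_eq_mul, matFunctional]
    refine Finset.sum_congr rfl fun i _ => Finset.sum_congr rfl fun j _ => ?_
    ring
  apply hf
  rw [key]
  exact h _ _ fun Y hY => by rw [← key]; exact hker hY

variable {D : StringDistribution} {𝔤 : Submodule ℝ (Matrix n n ℂ)}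

/-- A functional that annihilates 𝔤 makes s the zero function; differentiating that function gives
the functional of `∂_μ s`. -/
lemma pdMat_mem_lie {s : MatFun n} (hs : s ∈ rapidMat D n) (h : ∀ x, s x ∈ 𝔤) (μ : Fin 4)
    (x : Spacetime) : pdMat μ s x ∈ 𝔤 := by
  refine mem_of_functionals 𝔤 _ fun a b hab => ?_
  have hd : HasFDerivAt (fun y => matFunctional a b (s y))
      (∑ i, ∑ j, (a i j • fderiv ℝ (reEntry i j s) x + b i j • fderiv ℝ (imEntry i j s) x)) x := by
    refine HasFDerivAt.fun_sum fun i _ => HasFDerivAt.fun_sum fun j _ => ?_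
    exact ((hasFDerivAt_of_mem D (hs i j).1 x).const_mul _).add
      ((hasFDerivAt_of_mem D (hs i j).2 x).const_mul _)
  have hz : (fun y => matFunctional a b (s y)) = fun _ => 0 := by
    funext y; exact hab _ (h y)
  rw [hz] at hd
  have := congrArg (fun l : Spacetime →L[ℝ] ℝ => l (Pi.single μ 1))
    (hd.unique (hasFDerivAt_const 0 x))
  simpa [sum_apply, matFunctional, pdMat, pd] using this

lemma stringMat_mem_lie {v : Fin 4 → MatFun n} (hv : v ∈ rapidVec D n)
    (h : ∀ μ x, v μ x ∈ 𝔤) (x : Spacetime) : stringMat D v x ∈ 𝔤 := by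
  refine mem_of_functionals 𝔤 _ fun a b hab => ?_
  -- restricted to `D.V`, the pairing with `c` at `x` is linear
  let cl : D.V →ₗ[ℝ] ℝ :=
    { toFun := fun w => D.string w x
      map_add' := fun w w' => congrFun (D.string_add w.2 w'.2) x
      map_smul' := fun r w => congrFun (D.string_smul r w.2) x }
  let w : D.V := ∑ i, ∑ j, (a i j • ⟨_, (hv i j).1⟩ + b i j • ⟨_, (hv i j).2⟩)
  -- At each point the value of `w` is the functional with coefficients a, b applied to an element
  -- of 𝔤.
  have hw : w = 0 := by
    apply Subtype.ext
    funext μ y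
    have := hab _ (h μ y)
    simp only [w, Submodule.coe_sum, Submodule.coe_add, Submodule.coe_smul, Finset.sum_apply,
      Pi.add_apply, Pi.smul_apply, smul_eq_mul]
    exact this
  have h0 : cl w = 0 := by rw [hw, map_zero]
  simp only [w, map_sum, map_add, map_smul, smul_eq_mul] at h0
  exact h0

lemma IsLieScalar.grad {s : MatFun n} (hs : IsLieScalar D 𝔤 s) :
    IsLieVector D 𝔤 fun μ => pdMat μ s :=
  ⟨fun μ x => pdMat_mem_lie hs.2 hs.1 μ x, rapidVec_grad hs.2⟩

lemma IsLieVector.string {v : Fin 4 → MatFun n} (hv : IsLieVector D 𝔤 v) :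
    IsLieScalar D 𝔤 (stringMat D v) :=
  ⟨stringMat_mem_lie hv.2 hv.1, rapidMat_string hv.2⟩

lemma IsLieVector.ad (h𝔤 : IsCompactLieAlgebra 𝔤) {s : MatFun n} {v : Fin 4 → MatFun n}
    (hs : IsLieScalar D 𝔤 s) (hv : IsLieVector D 𝔤 v) :
    IsLieVector D 𝔤 fun μ => Complex.I • (s * v μ - v μ * s) :=
  ⟨fun μ x => h𝔤.2 _ (hs.1 x) _ (hv.1 μ x),
    (rapidVec D n).smul_mem Complex.I
      ((rapidVec D n).sub_mem (rapidVec_mul_left hs.2 hv.2) (rapidVec_mul_right hs.2 hv.2))⟩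

end LieValued

/-! ### Conjugation by truncated exponentials -/

/-- The square of pairs i, j < N differs from the triangle i + j < N only by terms that vanish by
hypothesis. -/
lemma sum_range_range_eq_sum_antidiagonal {M : Type*} [AddCommMonoid M] (f : ℕ → ℕ → M) (N : ℕ)
    (h : ∀ i j, N ≤ i + j → f i j = 0) :
    ∑ i ∈ Finset.range N, ∑ j ∈ Finset.range N, f i j =
      ∑ k ∈ Finset.range N, ∑ p ∈ Finset.HasAntidiagonal.antidiagonal k, f p.1 p.2 := by
  rw [← Finset.sum_product' (f := f)]
  have h1 : ∑ p ∈ Finset.range N ×ˢ Finset.range N, f p.1 p.2 =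
      ∑ p ∈ (Finset.range N ×ˢ Finset.range N).filter (fun p => p.1 + p.2 < N), f p.1 p.2 := by
    refine (Finset.sum_filter_of_ne fun p _ hp => ?_).symm
    by_contra hlt
    exact hp (h _ _ (not_lt.mp hlt))
  rw [h1, ← Finset.sum_fiberwise_of_maps_to (g := fun p : ℕ × ℕ => p.1 + p.2)
    (t := Finset.range N)]
  · refine Finset.sum_congr rfl fun k hk => Finset.sum_congr ?_ fun _ _ => rfl
    ext p
    simp only [Finset.mem_filter, Finset.mem_product, Finset.mem_range,
      Finset.HasAntidiagonal.mem_antidiagonal] at hk ⊢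
    omega
  · intro p hp
    simpa using (Finset.mem_filter.mp hp).2

/-- The commutator `[L, T]`. -/
def ringAd {E : Type*} [Ring E] (L T : E) : E := L * T - T * L

/-- ad_L is the sum of left multiplication by L and right multiplication by -L, which commute, so
the binomial theorem applies. -/
lemma ringAd_iterate {E : Type*} [Ring E] [Algebra ℂ E] (L T : E) (k : ℕ) :
    ((k.factorial : ℂ)⁻¹) • (ringAd L)^[k] T =
      ∑ p ∈ Finset.HasAntidiagonal.antidiagonal k, ((p.1.factorial : ℂ)⁻¹ * (p.2.factorial : ℂ)⁻¹) •
        (L ^ p.1 * (T * (-L) ^ p.2)) := by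
  have hpow : ∀ k, (ringAd L)^[k] T =
      ((LinearMap.mulLeft ℂ L + LinearMap.mulRight ℂ (-L)) ^ k) T := by
    intro k
    rw [Module.End.pow_apply]
    congr 1
    funext S
    simp [ringAd, sub_eq_add_neg]
  rw [hpow, Commute.add_pow' (LinearMap.commute_mulLeft_right L (-L)), LinearMap.sum_apply,
    Finset.smul_sum]
  refine Finset.sum_congr rfl fun p hp => ?_
  obtain rfl := Finset.HasAntidiagonal.mem_antidiagonal.mp hp
  rw [LinearMap.smul_apply, Module.End.mul_apply, LinearMap.pow_mulLeft, LinearMap.pow_mulRight,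
    LinearMap.mulRight_apply, LinearMap.mulLeft_apply, ← Nat.cast_smul_eq_nsmul ℂ, smul_smul]
  congr 1
  rw [Nat.cast_add_choose]
  have h1 : ((p.1 + p.2).factorial : ℂ) ≠ 0 := by exact_mod_cast Nat.factorial_ne_zero _
  have h2 : (p.1.factorial : ℂ) ≠ 0 := by exact_mod_cast Nat.factorial_ne_zero _
  have h3 : (p.2.factorial : ℂ) ≠ 0 := by exact_mod_cast Nat.factorial_ne_zero _
  field_simp

/-- The partial sum `∑_{k < N} u^k / k!` of the exponential series. -/
def truncExp {R : Type*} [Ring R] [Algebra ℂ R] (N : ℕ) (u : R) : R :=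
  ∑ k ∈ Finset.range N, ((k.factorial : ℂ)⁻¹) • u ^ k

/-- Conjugating an operator T, rather than a ring element, treats e^u v e^{-u} (T left
multiplication by v) and e^u ∂e^{-u} (T a derivation) at once. The map κ will extract a coefficient
of low order, for which the truncation makes no difference. -/
lemma map_truncExp_mul {R M : Type*} [Ring R] [Algebra ℂ R] [AddCommGroup M] [Module ℂ M]
    (κ : R →ₗ[ℂ] M) (u : R) (T : Module.End ℂ R) (N : ℕ)
    (h : ∀ i j, N ≤ i + j → κ (u ^ i * T ((-u) ^ j)) = 0) :
    κ (truncExp N u * T (truncExp N (-u))) =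
      ∑ k ∈ Finset.range N, ((k.factorial : ℂ)⁻¹) •
        κ ((ringAd (LinearMap.mulLeft ℂ u : Module.End ℂ R))^[k] T 1) := by
  have hR : ∀ k, ((k.factorial : ℂ)⁻¹) •
        κ ((ringAd (LinearMap.mulLeft ℂ u : Module.End ℂ R))^[k] T 1) =
      ∑ p ∈ Finset.HasAntidiagonal.antidiagonal k, ((p.1.factorial : ℂ)⁻¹ * (p.2.factorial : ℂ)⁻¹) •
        κ (u ^ p.1 * T ((-u) ^ p.2)) := by
    intro k
    rw [← map_smul, ← LinearMap.smul_apply, ringAd_iterate, LinearMap.sum_apply, map_sum]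
    refine Finset.sum_congr rfl fun p _ => ?_
    have hneg : -(LinearMap.mulLeft ℂ u : Module.End ℂ R) = LinearMap.mulLeft ℂ (-u) := by
      ext x; simp
    rw [LinearMap.smul_apply, map_smul, hneg, LinearMap.pow_mulLeft, LinearMap.pow_mulLeft,
      Module.End.mul_apply, Module.End.mul_apply, LinearMap.mulLeft_apply, LinearMap.mulLeft_apply,
      mul_one]
  rw [Finset.sum_congr rfl fun k _ => hR k,
    ← sum_range_range_eq_sum_antidiagonal (fun i j =>
      ((i.factorial : ℂ)⁻¹ * (j.factorial : ℂ)⁻¹) • κ (u ^ i * T ((-u) ^ j))) N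
      (fun i j hij => by rw [h i j hij, smul_zero])]
  simp only [truncExp, map_sum, map_smul, Finset.sum_mul_sum, smul_mul_smul_comm]

lemma ringAd_mulLeft {R : Type*} [Ring R] [Algebra ℂ R] (u v : R) (k : ℕ) :
    (ringAd (LinearMap.mulLeft ℂ u : Module.End ℂ R))^[k] (LinearMap.mulLeft ℂ v) =
      LinearMap.mulLeft ℂ ((ringAd u)^[k] v) := by
  induction k generalizing v with
  | zero => rfl
  | succ k ih =>
    rw [Function.iterate_succ_apply, Function.iterate_succ_apply, ← ih]
    congr 1
    ext x
    simp [ringAd, sub_mul, mul_assoc]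

/-- By the Leibniz rule the first commutator of left multiplication by u with δ is left
multiplication by -δu; the remaining k commutators are then those of `ringAd_mulLeft`. The shift
from k to k + 1 is the origin of the (k+1)! in `adExp`. -/
lemma ringAd_mulLeft_derivation {R : Type*} [Ring R] [Algebra ℂ R] (u : R)
    (δ : Module.End ℂ R) (hδ : ∀ x y, δ (x * y) = δ x * y + x * δ y) (k : ℕ) :
    (ringAd (LinearMap.mulLeft ℂ u : Module.End ℂ R))^[k + 1] δ =
      -LinearMap.mulLeft ℂ ((ringAd u)^[k] (δ u)) := by
  have h1 : ringAd (LinearMap.mulLeft ℂ u : Module.End ℂ R) δ =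
      LinearMap.mulLeft ℂ (-δ u) := by
    ext x
    simp [ringAd, hδ]
  rw [Function.iterate_succ_apply, h1, ringAd_mulLeft]
  have h2 : ∀ (k : ℕ) (v : R), (ringAd u)^[k] (-v) = -(ringAd u)^[k] v := by
    intro k
    induction k with
    | zero => intro v; rfl
    | succ k ih =>
      intro v
      rw [Function.iterate_succ_apply, Function.iterate_succ_apply, ← ih]
      congr 1
      simp only [ringAd]; noncomm_ring
  rw [h2]
  ext x; simp

/-! ### Orders of power series -/

section Order

variable {R : Type*} [Ring R]

/-- The power series has no coefficients of order below `k`. -/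
def VanishesBelow (k : ℕ) (F : PowerSeries R) : Prop := ∀ m < k, PowerSeries.coeff m F = 0

lemma VanishesBelow.mul {k l : ℕ} {F G : PowerSeries R} (hF : VanishesBelow k F)
    (hG : VanishesBelow l G) : VanishesBelow (k + l) (F * G) := by
  intro m hm
  rw [PowerSeries.coeff_mul]
  refine Finset.sum_eq_zero fun p hp => ?_
  have hp := Finset.HasAntidiagonal.mem_antidiagonal.mp hp
  rcases lt_or_ge p.1 k with h | h
  · rw [hF _ h, zero_mul]
  · rw [hG _ (by omega), mul_zero]

lemma VanishesBelow.pow {F : PowerSeries R} (hF : VanishesBelow 1 F) (k : ℕ) :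
    VanishesBelow k (F ^ k) := by
  induction k with
  | zero => intro m hm; omega
  | succ k ih => rw [pow_succ]; exact ih.mul hF

lemma vanishesBelow_zero (F : PowerSeries R) : VanishesBelow 0 F := fun _ h => absurd h (by omega)

lemma VanishesBelow.sub {k : ℕ} {F G : PowerSeries R} (hF : VanishesBelow k F)
    (hG : VanishesBelow k G) : VanishesBelow k (F - G) := fun m hm => by
  rw [map_sub, hF m hm, hG m hm, sub_zero]

lemma VanishesBelow.neg {k : ℕ} {F : PowerSeries R} (hF : VanishesBelow k F) :
    VanishesBelow k (-F) := fun m hm => by rw [map_neg, hF m hm, neg_zero]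

lemma VanishesBelow.ringAd_iterate {u : PowerSeries R} (hu : VanishesBelow 1 u)
    (v : PowerSeries R) (k : ℕ) : VanishesBelow k ((ringAd u)^[k] v) := by
  induction k with
  | zero => exact vanishesBelow_zero _
  | succ k ih =>
    rw [Function.iterate_succ_apply']
    exact (by simpa [add_comm] using hu.mul ih : VanishesBelow (k + 1) _).sub (ih.mul hu)

lemma vanishesBelow_one_X_mul (F : PowerSeries R) : VanishesBelow 1 (PowerSeries.X * F) := by
  intro m hm
  obtain rfl : m = 0 := by omega
  simp

lemma coeff_mul_congr {F F' G G' : PowerSeries R} {m : ℕ}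
    (hF : ∀ k ≤ m, PowerSeries.coeff k F = PowerSeries.coeff k F')
    (hG : ∀ k ≤ m, PowerSeries.coeff k G = PowerSeries.coeff k G') :
    PowerSeries.coeff m (F * G) = PowerSeries.coeff m (F' * G') := by
  rw [PowerSeries.coeff_mul, PowerSeries.coeff_mul]
  refine Finset.sum_congr rfl fun p hp => ?_
  have hp := Finset.HasAntidiagonal.mem_antidiagonal.mp hp
  rw [hF _ (by omega), hG _ (by omega)]

end Order

/-! ### The exponential series -/

section Exp

variable {n : Type} [Fintype n] [DecidableEq n]

lemma VanishesBelow.smul {k : ℕ} {F : MatSeries n} (hF : VanishesBelow k F) (a : ℂ) :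
    VanishesBelow k (a • F) := fun m hm => by
  rw [PowerSeries.coeff_smul, hF m hm, smul_zero]

lemma coeff_truncExp {u : MatSeries n} (hu : VanishesBelow 1 u) {m N : ℕ} (h : m < N) :
    PowerSeries.coeff m (truncExp N u) = PowerSeries.coeff m (expSeries u) := by
  simp only [truncExp, expSeries, map_sum, PowerSeries.coeff_mk, PowerSeries.coeff_smul]
  refine (Finset.sum_subset (by simpa using h) fun k _ hk => ?_).symm
  rw [hu.pow k m (by simpa using hk), smul_zero]

lemma coeff_zero_expSeries (u : MatSeries n) : PowerSeries.coeff 0 (expSeries u) = 1 := by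
  simp [expSeries]

lemma coeff_expSeries_mul_mul {u : MatSeries n} (hu : VanishesBelow 1 u) (v : MatSeries n)
    (m : ℕ) : PowerSeries.coeff m (expSeries u * v * expSeries (-u)) =
      ∑ k ∈ Finset.range (m + 1), ((k.factorial : ℂ)⁻¹) •
        PowerSeries.coeff m ((ringAd u)^[k] v) := by
  have h := map_truncExp_mul
    (κ := (PowerSeries.coeff m : MatSeries n →ₗ[MatFun n] MatFun n).restrictScalars ℂ)
    u (LinearMap.mulLeft ℂ v) (m + 1) (fun i j hij => by
      refine ((hu.pow i).mul ((vanishesBelow_zero v).mul (hu.neg.pow j))) m ?_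
      omega)
  simp only [ringAd_mulLeft, LinearMap.mulLeft_apply, mul_one,
    LinearMap.restrictScalars_apply] at h
  rw [← h, ← mul_assoc]
  exact coeff_mul_congr (fun k hk => coeff_mul_congr
    (fun l hl => (coeff_truncExp hu (by omega)).symm) fun _ _ => rfl)
    fun k hk => (coeff_truncExp hu.neg (by omega)).symm

lemma expSeries_mul_neg {u : MatSeries n} (hu : VanishesBelow 1 u) :
    expSeries u * expSeries (-u) = 1 := by
  ext1 m
  have h := coeff_expSeries_mul_mul hu 1 m
  rw [mul_one] at h
  rw [h, Finset.sum_eq_single_of_mem 0 (by simp)]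
  · simp
  · intro k _ hk
    obtain ⟨k, rfl⟩ := Nat.exists_eq_succ_of_ne_zero hk
    have h1 : ringAd u 1 = 0 := by simp [ringAd]
    have h0 : ∀ j, (ringAd u)^[j] 0 = 0 := fun j =>
      Function.iterate_fixed (by simp [ringAd]) j
    rw [Nat.succ_eq_add_one, Function.iterate_succ_apply, h1, h0, map_zero, smul_zero]

lemma expSeries_neg_mul {u : MatSeries n} (hu : VanishesBelow 1 u) :
    expSeries (-u) * expSeries u = 1 := by
  simpa using expSeries_mul_neg hu.neg

lemma inverse_eq_of_mul_eq_one {R : Type*} [Ring R] {a b : R} (h : a * b = 1) (h' : b * a = 1) :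
    Ring.inverse a = b :=
  Ring.inverse_unit (Units.mk a b h h')

lemma inverse_expSeries {u : MatSeries n} (hu : VanishesBelow 1 u) :
    Ring.inverse (expSeries u) = expSeries (-u) :=
  inverse_eq_of_mul_eq_one (expSeries_mul_neg hu) (expSeries_neg_mul hu)

lemma coeff_pow_congr {u v : MatSeries n} {m : ℕ}
    (h : ∀ k < m, PowerSeries.coeff k u = PowerSeries.coeff k v) (j : ℕ) :
    ∀ k < m, PowerSeries.coeff k (u ^ j) = PowerSeries.coeff k (v ^ j) := by
  induction j with
  | zero => intro k _; rfl
  | succ j ih =>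
    intro k hk
    rw [pow_succ, pow_succ]
    exact coeff_mul_congr (fun l hl => ih l (by omega)) fun l hl => h l (by omega)

/-- In order m > 0 the linear term of the exponential is the coefficient of u itself, and the higher
powers involve only coefficients of lower order because u has no constant term. -/
lemma expSeries_injective {u v : MatSeries n} (hu : VanishesBelow 1 u) (hv : VanishesBelow 1 v)
    (h : expSeries u = expSeries v) : u = v := by
  ext1 m
  induction m using Nat.strong_induction_on with
  | _ m ih =>
  rcases Nat.eq_zero_or_pos m with rfl | hm
  · rw [hu 0 one_pos, hv 0 one_pos]
  have hc := congrArg (PowerSeries.coeff m) h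
  simp only [expSeries, PowerSeries.coeff_mk] at hc
  obtain ⟨m, rfl⟩ := Nat.exists_eq_succ_of_ne_zero hm.ne'
  -- The terms k = 0 and k = 1 are split off on both sides, leaving powers with exponent at least 2.
  rw [Finset.sum_range_succ', Finset.sum_range_succ', Finset.sum_range_succ',
    Finset.sum_range_succ'] at hc
  have hrest : ∀ k, PowerSeries.coeff (m + 1) (u ^ (k + 1 + 1)) =
      PowerSeries.coeff (m + 1) (v ^ (k + 1 + 1)) := by
    intro k
    rw [pow_succ, pow_succ v, PowerSeries.coeff_mul, PowerSeries.coeff_mul]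
    refine Finset.sum_congr rfl fun p hp => ?_
    have hp := Finset.HasAntidiagonal.mem_antidiagonal.mp hp
    rcases Nat.eq_zero_or_pos p.1 with h1 | h1
    · rw [h1, hu.pow (k + 1) 0 (by omega), hv.pow (k + 1) 0 (by omega), zero_mul, zero_mul]
    rcases Nat.eq_zero_or_pos p.2 with h2 | h2
    · rw [h2, hu 0 one_pos, hv 0 one_pos, mul_zero, mul_zero]
    rw [coeff_pow_congr ih (k + 1) p.1 (by omega), ih p.2 (by omega)]
  simp only [hrest] at hc
  simpa using hc

end Exp

/-! ### Calculus of power series -/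

section Series

variable {n : Type} [Fintype n] [DecidableEq n]

@[simp]
lemma coeff_pdSeries (μ : Fin 4) (F : MatSeries n) (m : ℕ) :
    PowerSeries.coeff m (pdSeries μ F) = pdMat μ (PowerSeries.coeff m F) :=
  PowerSeries.coeff_mk _ _

@[simp]
lemma coeff_stringSeries (D : StringDistribution) (v : Fin 4 → MatSeries n) (m : ℕ) :
    PowerSeries.coeff m (stringSeries D v) = stringMat D fun μ => PowerSeries.coeff m (v μ) :=
  PowerSeries.coeff_mk _ _

@[simp]
lemma coeff_divCoupling (F : MatSeries n) (m : ℕ) :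
    PowerSeries.coeff m (divCoupling F) = PowerSeries.coeff (m + 1) F :=
  PowerSeries.coeff_mk _ _

lemma X_mul_divCoupling {F : MatSeries n} (hF : PowerSeries.coeff 0 F = 0) :
    PowerSeries.X * divCoupling F = F := by
  ext1 m
  cases m with
  | zero => simpa using hF.symm
  | succ m => rw [PowerSeries.coeff_succ_X_mul, coeff_divCoupling]

lemma X_mul_cancel {F G : MatSeries n} (h : PowerSeries.X * F = PowerSeries.X * G) : F = G := by
  ext1 m
  rw [← PowerSeries.coeff_succ_X_mul, h, PowerSeries.coeff_succ_X_mul]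

/-- Power series whose coefficients are smooth. -/
def smoothSeries (n : Type) [Fintype n] [DecidableEq n] : Subalgebra ℂ (MatSeries n) where
  carrier := {F | ∀ m, SmoothMat (PowerSeries.coeff m F)}
  mul_mem' {F G} hF hG m := by
    rw [PowerSeries.coeff_mul]
    exact Finset.sum_induction _ SmoothMat (fun _ _ => SmoothMat.add) SmoothMat.zero
      fun p _ => (hF p.1).mul (hG p.2)
  add_mem' {F G} hF hG m := by
    rw [map_add]; exact (hF m).add (hG m)
  algebraMap_mem' a m := by
    rw [Algebra.algebraMap_eq_smul_one, PowerSeries.coeff_smul, PowerSeries.coeff_one]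
    split_ifs
    · exact SmoothMat.one.smul a
    · exact SmoothMat.zero.smul a

lemma pdSeries_add {F G : MatSeries n} (hF : F ∈ smoothSeries n) (hG : G ∈ smoothSeries n)
    (μ : Fin 4) : pdSeries μ (F + G) = pdSeries μ F + pdSeries μ G := by
  ext1 m
  simp only [coeff_pdSeries, map_add, pdMat_add (hF m) (hG m)]

lemma pdSeries_smul (a : ℂ) {F : MatSeries n} (hF : F ∈ smoothSeries n) (μ : Fin 4) :
    pdSeries μ (a • F) = a • pdSeries μ F := by
  ext1 m
  simp only [coeff_pdSeries, PowerSeries.coeff_smul, pdMat_smul a (hF m)]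

lemma pdMat_sum {ι : Type*} (s : Finset ι) (f : ι → MatFun n) (hf : ∀ i ∈ s, SmoothMat (f i))
    (μ : Fin 4) : pdMat μ (∑ i ∈ s, f i) = ∑ i ∈ s, pdMat μ (f i) := by
  classical
  induction s using Finset.induction_on with
  | empty => simp [pdMat_zero]
  | insert a s ha ih =>
    have hs : ∀ i ∈ s, SmoothMat (f i) := fun i hi => hf i (Finset.mem_insert_of_mem hi)
    rw [Finset.sum_insert ha, Finset.sum_insert ha, pdMat_add (hf a (Finset.mem_insert_self a s))
      (Finset.sum_induction _ SmoothMat (fun _ _ => SmoothMat.add) SmoothMat.zero hs), ih hs]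

lemma pdSeries_mul {F G : MatSeries n} (hF : F ∈ smoothSeries n) (hG : G ∈ smoothSeries n)
    (μ : Fin 4) : pdSeries μ (F * G) = pdSeries μ F * G + F * pdSeries μ G := by
  ext1 m
  rw [coeff_pdSeries, map_add, PowerSeries.coeff_mul, PowerSeries.coeff_mul, PowerSeries.coeff_mul,
    pdMat_sum _ _ (fun p _ => (hF p.1).mul (hG p.2)), ← Finset.sum_add_distrib]
  refine Finset.sum_congr rfl fun p _ => ?_
  rw [pdMat_mul (hF p.1) (hG p.2), coeff_pdSeries, coeff_pdSeries]

lemma pdSeries_mem_smooth {F : MatSeries n} (hF : F ∈ smoothSeries n) (μ : Fin 4) :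
    pdSeries μ F ∈ smoothSeries n := fun m => by
  rw [coeff_pdSeries]; exact (hF m).pdMat μ

lemma pdSeries_one (μ : Fin 4) : pdSeries μ (1 : MatSeries n) = 0 := by
  ext1 m
  rw [coeff_pdSeries, PowerSeries.coeff_one]
  split_ifs
  · simp [pdMat_one]
  · simp [pdMat_zero]

lemma pdSeries_X_mul (F : MatSeries n) (μ : Fin 4) :
    pdSeries μ (PowerSeries.X * F) = PowerSeries.X * pdSeries μ F := by
  ext1 m
  cases m with
  | zero => simp [pdMat_zero]
  | succ m => simp only [coeff_pdSeries, PowerSeries.coeff_succ_X_mul]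

/-- `∂_μ` as a linear operator on smooth power series. -/
def pdSmooth (μ : Fin 4) : Module.End ℂ (smoothSeries n) where
  toFun F := ⟨pdSeries μ F, pdSeries_mem_smooth F.2 μ⟩
  map_add' F G := Subtype.ext (pdSeries_add F.2 G.2 μ)
  map_smul' a F := Subtype.ext (pdSeries_smul a F.2 μ)

lemma coe_ringAd_iterate (u v : smoothSeries n) (k : ℕ) :
    (((ringAd u)^[k] v : smoothSeries n) : MatSeries n) =
      (ringAd (u : MatSeries n))^[k] (v : MatSeries n) := by
  induction k generalizing v with
  | zero => rfl
  | succ k ih =>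
    rw [Function.iterate_succ_apply, ih, Function.iterate_succ_apply]
    rfl

lemma coe_truncExp (u : smoothSeries n) (N : ℕ) :
    ((truncExp N u : smoothSeries n) : MatSeries n) = truncExp N (u : MatSeries n) := by
  simp [truncExp]

lemma coeff_expSeries_mul_pdSeries {u : MatSeries n} (hu : VanishesBelow 1 u)
    (hs : u ∈ smoothSeries n) (μ : Fin 4) (m : ℕ) :
    PowerSeries.coeff m (expSeries u * pdSeries μ (expSeries (-u))) =
      -∑ k ∈ Finset.range (m + 1), (((k + 1).factorial : ℂ)⁻¹) •
        PowerSeries.coeff m ((ringAd u)^[k] (pdSeries μ u)) := by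
  let u' : smoothSeries n := ⟨u, hs⟩
  have hpd : ∀ {k : ℕ} {F : MatSeries n}, VanishesBelow k F → VanishesBelow k (pdSeries μ F) := by
    intro k F hF j hj
    rw [coeff_pdSeries, hF j hj, pdMat_zero]
  -- The computation takes place in the subalgebra of smooth series, where ∂ is a derivation. The
  -- truncation is at m + 2 because the k = 0 term is ∂1 = 0 and the others are reindexed as k + 1
  -- with k ≤ m.
  have h := map_truncExp_mul
    (κ := ((PowerSeries.coeff m : MatSeries n →ₗ[MatFun n] MatFun n).restrictScalars ℂ).comp
      (smoothSeries n).val.toLinearMap) u' (pdSmooth μ) (m + 2) (fun i j hij => by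
      refine ((hu.pow i).mul (hpd (hu.neg.pow j))) m ?_
      omega)
  rw [Finset.sum_range_succ'] at h
  have hder : ∀ x y : smoothSeries n, pdSmooth μ (x * y) = pdSmooth μ x * y + x * pdSmooth μ y :=
    fun x y => Subtype.ext (pdSeries_mul x.2 y.2 μ)
  simp only [ringAd_mulLeft_derivation u' (pdSmooth μ) hder] at h
  simp only [LinearMap.comp_apply, LinearMap.restrictScalars_apply, LinearMap.neg_apply,
    LinearMap.mulLeft_apply, mul_one, map_neg, Function.iterate_zero, id,
    AlgHom.toLinearMap_apply, Subalgebra.coe_val, coe_ringAd_iterate, smul_neg,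
    Finset.sum_neg_distrib] at h
  have h1 : ((pdSmooth μ (1 : smoothSeries n) : smoothSeries n) : MatSeries n) = 0 :=
    pdSeries_one μ
  rw [h1, map_zero, smul_zero, add_zero] at h
  refine Eq.trans ?_ h
  have e1 : ((truncExp (m + 2) u' * pdSmooth μ (truncExp (m + 2) (-u')) : smoothSeries n) :
      MatSeries n) = truncExp (m + 2) u * pdSeries μ (truncExp (m + 2) (-u)) := by
    have := coe_truncExp (-u') (m + 2)
    rw [Subalgebra.coe_mul, coe_truncExp]
    change _ * pdSeries μ _ = _
    rw [this]
    rfl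
  rw [e1]
  refine coeff_mul_congr (fun k hk => (coeff_truncExp hu (by omega)).symm) fun k hk => ?_
  rw [coeff_pdSeries, coeff_pdSeries, coeff_truncExp hu.neg (by omega)]

end Series

/-! ### Spaces of potentials and gauge parameters -/

section Spaces

variable {n : Type} [Fintype n] [DecidableEq n] (D : StringDistribution)
  (𝔤 : Submodule ℝ (Matrix n n ℂ))

/-- The real space of `𝔤`-valued vector fields of rapid decay. -/
def lieVectors : Submodule ℝ (Fin 4 → MatFun n) where
  carrier := {v | IsLieVector D 𝔤 v}
  zero_mem' := ⟨fun _ _ => 𝔤.zero_mem, (rapidVec D n).zero_mem⟩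
  add_mem' hv hw := ⟨fun μ x => 𝔤.add_mem (hv.1 μ x) (hw.1 μ x), (rapidVec D n).add_mem hv.2 hw.2⟩
  smul_mem' r v hv := ⟨fun μ x => 𝔤.smul_mem r (hv.1 μ x), by
    have := (rapidVec D n).smul_mem (r : ℂ) hv.2
    rwa [Complex.coe_smul] at this⟩

/-- The real space of `𝔤`-valued functions of rapid decay. -/
def lieScalars : Submodule ℝ (MatFun n) where
  carrier := {s | IsLieScalar D 𝔤 s}
  zero_mem' := ⟨fun _ => 𝔤.zero_mem, (rapidMat D n).zero_mem⟩
  add_mem' hv hw := ⟨fun x => 𝔤.add_mem (hv.1 x) (hw.1 x), (rapidMat D n).add_mem hv.2 hw.2⟩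
  smul_mem' r v hv := ⟨fun x => 𝔤.smul_mem r (hv.1 x), by
    have := (rapidMat D n).smul_mem (r : ℂ) hv.2
    rwa [Complex.coe_smul] at this⟩

/-- The real space of potentials. -/
def potentials : Submodule ℝ (Fin 4 → MatSeries n) where
  carrier := {A | IsPotential D 𝔤 A}
  zero_mem' _ := (lieVectors D 𝔤).zero_mem
  add_mem' hA hB m := (lieVectors D 𝔤).add_mem (hA m) (hB m)
  smul_mem' r _ hA m := (lieVectors D 𝔤).smul_mem r (hA m)

/-- The real space of gauge parameters. -/
def gaugeParameters : Submodule ℝ (MatSeries n) where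
  carrier := {s | IsGaugeParameter D 𝔤 s}
  zero_mem' _ := (lieScalars D 𝔤).zero_mem
  add_mem' hA hB m := (lieScalars D 𝔤).add_mem (hA m) (hB m)
  smul_mem' r _ hA m := (lieScalars D 𝔤).smul_mem r (hA m)

variable {D 𝔤}

lemma lieVectors_sum {ι : Type*} {t : Finset ι} {f : ι → Fin 4 → MatFun n}
    (h : ∀ i ∈ t, IsLieVector D 𝔤 (f i)) : IsLieVector D 𝔤 fun μ => ∑ i ∈ t, f i μ := by
  have := (lieVectors D 𝔤).sum_mem (t := t) h
  rwa [show ∑ i ∈ t, f i = fun μ => ∑ i ∈ t, f i μ from funext fun μ => Finset.sum_apply _ _ _]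
    at this

lemma IsPotential.top {A : Fin 4 → MatSeries n} (h : IsPotential D 𝔤 A) : IsPotential D ⊤ A :=
  fun m => ⟨fun _ _ => trivial, (h m).2⟩

lemma IsGaugeParameter.top {s : MatSeries n} (h : IsGaugeParameter D 𝔤 s) :
    IsGaugeParameter D ⊤ s :=
  fun m => ⟨fun _ => trivial, (h m).2⟩

lemma IsGaugeParameter.smooth {s : MatSeries n} (h : IsGaugeParameter D 𝔤 s) :
    s ∈ smoothSeries n := fun m => smoothMat_of_rapid (h m).2

lemma IsPotential.X_mul {A : Fin 4 → MatSeries n} (h : IsPotential D 𝔤 A) :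
    IsPotential D 𝔤 fun μ => PowerSeries.X * A μ := by
  intro m
  cases m with
  | zero =>
    simp only [PowerSeries.coeff_zero_X_mul]
    exact (lieVectors D 𝔤).zero_mem
  | succ m => simpa only [PowerSeries.coeff_succ_X_mul] using h m

lemma IsGaugeParameter.X_mul {s : MatSeries n} (h : IsGaugeParameter D 𝔤 s) :
    IsGaugeParameter D 𝔤 (PowerSeries.X * s) := by
  intro m
  cases m with
  | zero =>
    simp only [PowerSeries.coeff_zero_X_mul]
    exact (lieScalars D 𝔤).zero_mem
  | succ m => simpa only [PowerSeries.coeff_succ_X_mul] using h m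

lemma IsGaugeParameter.grad {s : MatSeries n} (h : IsGaugeParameter D 𝔤 s) :
    IsPotential D 𝔤 fun μ => pdSeries μ s := fun m => by
  simpa only [coeff_pdSeries] using (h m).grad

lemma IsPotential.string {v : Fin 4 → MatSeries n} (h : IsPotential D 𝔤 v) :
    IsGaugeParameter D 𝔤 (stringSeries D v) := fun m => by
  simpa only [coeff_stringSeries] using (h m).string

/-! ### Closure under products, commutators and string integration; rules for string integrals of
series -/

/-- `ad_{is}(v) = i[s, v]` for power series. -/
def lieAd (s v : MatSeries n) : MatSeries n := Complex.I • (s * v - v * s)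

lemma coeff_lieAd (s v : MatSeries n) (m : ℕ) : PowerSeries.coeff m (lieAd s v) =
    ∑ p ∈ Finset.HasAntidiagonal.antidiagonal m, Complex.I •
      (PowerSeries.coeff p.1 s * PowerSeries.coeff p.2 v -
        PowerSeries.coeff p.2 v * PowerSeries.coeff p.1 s) := by
  rw [lieAd, PowerSeries.coeff_smul, map_sub, PowerSeries.coeff_mul, PowerSeries.coeff_mul,
    ← Finset.Nat.sum_antidiagonal_swap
      (f := fun p => PowerSeries.coeff p.1 v * PowerSeries.coeff p.2 s),
    ← Finset.sum_sub_distrib, Finset.smul_sum]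
  rfl

lemma IsPotential.lieAd (h𝔤 : IsCompactLieAlgebra 𝔤) {s : MatSeries n} {v : Fin 4 → MatSeries n}
    (hs : IsGaugeParameter D 𝔤 s) (hv : IsPotential D 𝔤 v) :
    IsPotential D 𝔤 fun μ => lieAd s (v μ) := fun m => by
  simp only [coeff_lieAd]
  exact lieVectors_sum fun p _ => IsLieVector.ad h𝔤 (hs p.1) (hv p.2)

lemma IsPotential.lieAd_iterate (h𝔤 : IsCompactLieAlgebra 𝔤) {s : MatSeries n}
    {v : Fin 4 → MatSeries n} (hs : IsGaugeParameter D 𝔤 s) (hv : IsPotential D 𝔤 v) (k : ℕ) :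
    IsPotential D 𝔤 fun μ => (_root_.lieAd s)^[k] (v μ) := by
  induction k with
  | zero => exact hv
  | succ k ih =>
    simp only [Function.iterate_succ_apply']
    exact ih.lieAd h𝔤 hs

lemma IsPotential.mul_left {s : MatSeries n} {v : Fin 4 → MatSeries n}
    (hs : IsGaugeParameter D ⊤ s) (hv : IsPotential D ⊤ v) :
    IsPotential D ⊤ fun μ => s * v μ := fun m => by
  simp only [PowerSeries.coeff_mul]
  exact lieVectors_sum fun p _ =>
    ⟨fun _ _ => trivial, rapidVec_mul_left (hs p.1).2 (hv p.2).2⟩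

lemma IsPotential.mul_right {s : MatSeries n} {v : Fin 4 → MatSeries n}
    (hs : IsGaugeParameter D ⊤ s) (hv : IsPotential D ⊤ v) :
    IsPotential D ⊤ fun μ => v μ * s := fun m => by
  simp only [PowerSeries.coeff_mul]
  exact lieVectors_sum fun p _ =>
    ⟨fun _ _ => trivial, rapidVec_mul_right (hs p.2).2 (hv p.1).2⟩

lemma IsGaugeParameter.mul {s t : MatSeries n}
    (hs : IsGaugeParameter D ⊤ s) (ht : IsGaugeParameter D ⊤ t) :
    IsGaugeParameter D ⊤ (s * t) := fun m => by
  rw [PowerSeries.coeff_mul]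
  exact (lieScalars D ⊤).sum_mem fun p _ =>
    ⟨fun _ => trivial, rapidMat_mul (hs p.1).2 (ht p.2).2⟩

lemma IsPotential.smul_complex {v : Fin 4 → MatSeries n} (hv : IsPotential D ⊤ v) (a : ℂ) :
    IsPotential D ⊤ fun μ => a • v μ := fun m =>
  ⟨fun _ _ => trivial, (rapidVec D n).smul_mem a (hv m).2⟩

lemma IsGaugeParameter.smul_complex {s : MatSeries n} (hs : IsGaugeParameter D ⊤ s) (a : ℂ) :
    IsGaugeParameter D ⊤ (a • s) := fun m =>
  ⟨fun _ => trivial, (rapidMat D n).smul_mem a (hs m).2⟩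

lemma IsPotential.add {v w : Fin 4 → MatSeries n} (hv : IsPotential D 𝔤 v)
    (hw : IsPotential D 𝔤 w) : IsPotential D 𝔤 fun μ => v μ + w μ :=
  (potentials D 𝔤).add_mem hv hw

lemma stringSeries_add {v w : Fin 4 → MatSeries n} (hv : IsPotential D 𝔤 v)
    (hw : IsPotential D 𝔤 w) :
    stringSeries D (v + w) = stringSeries D v + stringSeries D w := by
  ext1 m
  simp only [map_add, coeff_stringSeries]
  exact stringMat_add (hv m).2 (hw m).2

lemma stringSeries_smul (r : ℝ) {v : Fin 4 → MatSeries n} (hv : IsPotential D 𝔤 v) :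
    stringSeries D (r • v) = r • stringSeries D v := by
  ext1 m
  rw [PowerSeries.coeff_smul]
  simp only [coeff_stringSeries]
  have := stringMat_smul (r : ℂ) (hv m).2
  rw [Complex.coe_smul, Complex.coe_smul] at this
  exact this

lemma stringSeries_zero : stringSeries D (0 : Fin 4 → MatSeries n) = 0 := by
  ext1 m
  rw [coeff_stringSeries, map_zero]
  exact stringMat_zero

lemma stringSeries_X_mul (v : Fin 4 → MatSeries n) :
    stringSeries D (fun μ => PowerSeries.X * v μ) = PowerSeries.X * stringSeries D v := by
  ext1 m
  cases m with
  | zero =>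
    simp only [coeff_stringSeries, PowerSeries.coeff_zero_X_mul]
    exact stringMat_zero
  | succ m => simp only [coeff_stringSeries, PowerSeries.coeff_succ_X_mul]

lemma stringSeries_grad {s : MatSeries n} (hs : IsGaugeParameter D 𝔤 s) :
    stringSeries D (fun μ => pdSeries μ s) = -s := by
  ext1 m
  simp only [coeff_stringSeries, coeff_pdSeries, stringMat_grad (hs m).2, map_neg]

lemma pdSeries_stringSeries {v : Fin 4 → MatSeries n} (hv : IsPotential D 𝔤 v) (μ : Fin 4) :
    pdSeries μ (stringSeries D v) = stringSeries D fun ν => pdSeries μ (v ν) := by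
  ext1 m
  simp only [coeff_stringSeries, coeff_pdSeries, pdMat_stringMat (hv m).2]

end Spaces

/-! ### Gauge transformations by exponentials -/

section Gauge

variable {n : Type} [Fintype n] [DecidableEq n] {D : StringDistribution}
  {𝔤 : Submodule ℝ (Matrix n n ℂ)}

/-- The power series `∑_k ad_{is}^k(v) / k! + ∑_k ad_{is}^k(w) / (k+1)!`, for `s` without term of
order `g^0`. -/
def adExp (s v w : MatSeries n) : MatSeries n :=
  PowerSeries.mk fun m => ∑ k ∈ Finset.range (m + 1),
    (((k.factorial : ℂ)⁻¹) • PowerSeries.coeff m ((lieAd s)^[k] v) +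
      (((k + 1).factorial : ℂ)⁻¹) • PowerSeries.coeff m ((lieAd s)^[k] w))

lemma ringAd_I_smul (s : MatSeries n) : ringAd (Complex.I • s) = lieAd s := by
  funext v
  simp only [ringAd, lieAd, smul_sub, smul_mul_assoc, mul_smul_comm]

lemma lieAd_X_mul_right (s v : MatSeries n) :
    lieAd s (PowerSeries.X * v) = PowerSeries.X * lieAd s v := by
  have h : s * PowerSeries.X = PowerSeries.X * s := PowerSeries.X_mul.symm
  simp only [lieAd, mul_smul_comm, mul_sub]
  rw [← mul_assoc s, h, mul_assoc, mul_assoc]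

lemma lieAd_iterate_X_mul (s v : MatSeries n) (k : ℕ) :
    (lieAd s)^[k] (PowerSeries.X * v) = PowerSeries.X * (lieAd s)^[k] v := by
  induction k with
  | zero => rfl
  | succ k ih => rw [Function.iterate_succ_apply', ih, lieAd_X_mul_right,
      Function.iterate_succ_apply']

lemma lieAd_smul (s v : MatSeries n) (a : ℂ) : lieAd s (a • v) = a • lieAd s v := by
  simp only [lieAd, mul_smul_comm, smul_mul_assoc, ← smul_sub, smul_comm a]

lemma lieAd_iterate_smul (s v : MatSeries n) (a : ℂ) (k : ℕ) :
    (lieAd s)^[k] (a • v) = a • (lieAd s)^[k] v := by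
  induction k with
  | zero => rfl
  | succ k ih => rw [Function.iterate_succ_apply', ih, lieAd_smul, Function.iterate_succ_apply']

lemma vanishesBelow_I_smul_X_mul (G : MatSeries n) :
    VanishesBelow 1 (Complex.I • (PowerSeries.X * G)) :=
  (vanishesBelow_one_X_mul G).smul _

lemma VanishesBelow.lieAd_iterate (G v : MatSeries n) (k : ℕ) :
    VanishesBelow k ((lieAd (PowerSeries.X * G))^[k] v) := by
  rw [← ringAd_I_smul]
  exact (vanishesBelow_I_smul_X_mul G).ringAd_iterate v k

lemma IsGaugeParameter.smooth_I_smul_X_mul {G : MatSeries n} (hG : IsGaugeParameter D 𝔤 G) :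
    Complex.I • (PowerSeries.X * G) ∈ smoothSeries n :=
  (smoothSeries n).smul_mem hG.X_mul.smooth _

/-- Gauge transformation by `exp(-i g G)`. -/
lemma gaugeTransform_expSeries_neg {G : MatSeries n} (hG : IsGaugeParameter D 𝔤 G)
    (A : Fin 4 → MatSeries n) (μ : Fin 4) :
    gaugeTransform (expSeries (-(Complex.I • (PowerSeries.X * G)))) A μ =
      adExp (PowerSeries.X * G) (A μ) (pdSeries μ G) := by
  have hu := vanishesBelow_I_smul_X_mul G
  ext1 m
  rw [gaugeTransform, inverse_expSeries hu.neg, neg_neg, map_add, PowerSeries.coeff_smul,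
    coeff_divCoupling, coeff_expSeries_mul_mul hu,
    coeff_expSeries_mul_pdSeries hu hG.smooth_I_smul_X_mul, adExp, PowerSeries.coeff_mk,
    Finset.sum_add_distrib, ringAd_I_smul, pdSeries_smul _ hG.X_mul.smooth, pdSeries_X_mul]
  congr 1
  -- Division by g reads off order m + 1, so the sum runs up to k = m + 1; its last term vanishes
  -- because one factor g comes from ∂(gG) and m + 1 more from the commutators. Below, i · i = -1
  -- cancels the sign of e^u ∂e^{-u}.
  rw [Finset.sum_range_succ]
  simp only [lieAd_iterate_smul, lieAd_iterate_X_mul, PowerSeries.coeff_smul,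
    PowerSeries.coeff_succ_X_mul]
  rw [VanishesBelow.lieAd_iterate G _ (m + 1) m (by omega), smul_zero, smul_zero, add_zero,
    smul_neg, Finset.smul_sum, ← Finset.sum_neg_distrib]
  refine Finset.sum_congr rfl fun k _ => ?_
  rw [smul_comm Complex.I, smul_smul Complex.I, Complex.I_mul_I, neg_smul, one_smul, smul_neg,
    neg_neg]

lemma inv_natCast_smul (k : ℕ) (f : MatFun n) : ((k : ℂ)⁻¹) • f = ((k : ℝ)⁻¹) • f := by
  rw [← Complex.coe_smul]
  push_cast
  rfl

lemma IsPotential.adExp (h𝔤 : IsCompactLieAlgebra 𝔤) {s : MatSeries n}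
    {v w : Fin 4 → MatSeries n} (hs : IsGaugeParameter D 𝔤 s) (hv : IsPotential D 𝔤 v)
    (hw : IsPotential D 𝔤 w) : IsPotential D 𝔤 fun μ => adExp s (v μ) (w μ) := by
  intro m
  simp only [_root_.adExp, PowerSeries.coeff_mk, inv_natCast_smul]
  exact lieVectors_sum fun k _ => (lieVectors D 𝔤).add_mem
    ((lieVectors D 𝔤).smul_mem _ (hv.lieAd_iterate h𝔤 hs k m))
    ((lieVectors D 𝔤).smul_mem _ (hw.lieAd_iterate h𝔤 hs k m))

lemma IsGaugeParameter.neg {l : MatSeries n} (hl : IsGaugeParameter D 𝔤 l) :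
    IsGaugeParameter D 𝔤 (-l) := (gaugeParameters D 𝔤).neg_mem hl

lemma gaugeFunction_eq (l : MatSeries n) :
    gaugeFunction l = expSeries (-(Complex.I • (PowerSeries.X * -l))) := by
  rw [gaugeFunction, mul_neg, smul_neg, neg_neg]

/-- Neither θ nor the separate factors are 𝔤-valued. The commutator expansion writes A^θ with real
coefficients and iterated i[·,·] of 𝔤-valued series, for which closure is clear. -/
lemma IsPotential.gaugeTransform (h𝔤 : IsCompactLieAlgebra 𝔤) {l : MatSeries n}
    (hl : IsGaugeParameter D 𝔤 l) {A : Fin 4 → MatSeries n} (hA : IsPotential D 𝔤 A) :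
    IsPotential D 𝔤 (gaugeTransform (gaugeFunction l) A) := by
  rw [gaugeFunction_eq, show _root_.gaugeTransform _ A = _ from
    funext (gaugeTransform_expSeries_neg hl.neg A)]
  exact hA.adExp h𝔤 hl.neg.X_mul hl.neg.grad

/-! ### Uniqueness of the dressing factor -/

/-- Power series `1 + O(g)` whose higher coefficients decay rapidly. -/
def IsUnipotent (D : StringDistribution) (F : MatSeries n) : Prop :=
  PowerSeries.coeff 0 F = 1 ∧ IsGaugeParameter D ⊤ (F - 1)

lemma IsUnipotent.smooth {F : MatSeries n} (hF : IsUnipotent D F) : F ∈ smoothSeries n := by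
  have := (smoothSeries n).add_mem hF.2.smooth (smoothSeries n).one_mem
  rwa [sub_add_cancel] at this

lemma IsUnipotent.mul {F G : MatSeries n} (hF : IsUnipotent D F) (hG : IsUnipotent D G) :
    IsUnipotent D (F * G) := by
  constructor
  · simp [PowerSeries.coeff_mul, hF.1, hG.1]
  · have : F * G - 1 = (F - 1) * (G - 1) + ((F - 1) + (G - 1)) := by noncomm_ring
    rw [this]
    exact (gaugeParameters D ⊤).add_mem (hF.2.mul hG.2) ((gaugeParameters D ⊤).add_mem hF.2 hG.2)

lemma isUnipotent_expSeries {u : MatSeries n} (hu : IsGaugeParameter D ⊤ u) :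
    IsUnipotent D (expSeries u) := by
  refine ⟨coeff_zero_expSeries u, fun m => ?_⟩
  have hpow : ∀ k, IsGaugeParameter D ⊤ (u ^ (k + 1)) := by
    intro k
    induction k with
    | zero => simpa using hu
    | succ k ih => rw [pow_succ]; exact ih.mul hu
  rw [map_sub, expSeries, PowerSeries.coeff_mk, Finset.sum_range_succ']
  simp only [Nat.factorial_zero, Nat.cast_one, inv_one, one_smul, pow_zero, add_sub_cancel_right]
  exact (lieScalars D ⊤).sum_mem fun k _ => ((hpow k).smul_complex _) m

lemma IsUnipotent.mul_potential {F : MatSeries n} (hF : IsUnipotent D F)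
    {v : Fin 4 → MatSeries n} (hv : IsPotential D ⊤ v) : IsPotential D ⊤ fun μ => F * v μ := by
  have := (hv.mul_left hF.2).add hv
  simpa only [sub_mul, one_mul, sub_add_cancel] using this

lemma IsUnipotent.potential_mul {F : MatSeries n} (hF : IsUnipotent D F)
    {v : Fin 4 → MatSeries n} (hv : IsPotential D ⊤ v) : IsPotential D ⊤ fun μ => v μ * F := by
  have := (hv.mul_right hF.2).add hv
  simpa only [mul_sub, mul_one, sub_add_cancel] using this

lemma IsUnipotent.grad {F : MatSeries n} (hF : IsUnipotent D F) :
    IsPotential D ⊤ fun μ => pdSeries μ F := by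
  have h : ∀ μ, pdSeries μ F = pdSeries μ (F - 1) := fun μ => by
    conv_lhs => rw [← sub_add_cancel F 1,
      pdSeries_add hF.2.smooth (smoothSeries n).one_mem, pdSeries_one, add_zero]
  simp only [h]
  exact hF.2.grad

/-- The vector field `W (g A + i ∂) V`, where `V` stands for the inverse of `W`. -/
def dressedForm (W V : MatSeries n) (A : Fin 4 → MatSeries n) (μ : Fin 4) : MatSeries n :=
  W * (PowerSeries.X * A μ) * V + Complex.I • (W * pdSeries μ V)

lemma IsUnipotent.dressedForm_mem {W V : MatSeries n} (hW : IsUnipotent D W)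
    (hV : IsUnipotent D V) {A : Fin 4 → MatSeries n} (hA : IsPotential D ⊤ A) :
    IsPotential D ⊤ (dressedForm W V A) :=
  (hV.potential_mul (hW.mul_potential hA.X_mul)).add
    ((hW.mul_potential hV.grad).smul_complex _)

lemma coeff_zero_dressedForm {W V : MatSeries n} (hV : IsUnipotent D V)
    (A : Fin 4 → MatSeries n) (μ : Fin 4) : PowerSeries.coeff 0 (dressedForm W V A μ) = 0 := by
  simp only [dressedForm, map_add, PowerSeries.coeff_smul, PowerSeries.coeff_mul,
    Finset.Nat.antidiagonal_zero, Finset.sum_singleton, PowerSeries.coeff_zero_X,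
    coeff_pdSeries, hV.1, pdMat_one]
  simp

/-- Multiplication by g undoes the division in A^θ, which loses nothing because θ = 1 + O(g) forces
θ⁻¹∂θ = O(g). -/
lemma X_mul_gaugeTransform {θ V : MatSeries n} (hθ : IsUnipotent D θ) (h1 : θ * V = 1)
    (h2 : V * θ = 1) (A : Fin 4 → MatSeries n) (μ : Fin 4) :
    PowerSeries.X * gaugeTransform θ A μ = dressedForm V θ A μ := by
  have h0 : PowerSeries.coeff 0 (V * pdSeries μ θ) = 0 := by
    simp [PowerSeries.coeff_mul, hθ.1, pdMat_one]
  have hX : ∀ F G : MatSeries n, PowerSeries.X * (F * G) = F * (PowerSeries.X * G) := fun F G => by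
    rw [← mul_assoc, PowerSeries.X_mul, mul_assoc]
  rw [gaugeTransform, inverse_eq_of_mul_eq_one h1 h2, mul_add, mul_smul_comm, X_mul_divCoupling h0,
    dressedForm, mul_assoc V, hX, mul_assoc V, mul_assoc PowerSeries.X]

/-- Induction on the order. If U = 1 + O(g^m) with m > 0, order m of the relation contains U only
through ∂U_m, because B and B' start at order g. String integration removes B_m and B'_m and turns
-i∂U_m into iU_m. -/
lemma eq_one_of_intertwines {U : MatSeries n} {B B' : Fin 4 → MatSeries n}
    (hU : IsUnipotent D U) (hB : IsPotential D ⊤ B) (hB0 : ∀ μ, PowerSeries.coeff 0 (B μ) = 0)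
    (hB0' : ∀ μ, PowerSeries.coeff 0 (B' μ) = 0)
    (hs : stringSeries D B = 0) (hs' : stringSeries D B' = 0)
    (h : ∀ μ, B' μ * U = U * B μ - Complex.I • pdSeries μ U) : U = 1 := by
  ext1 m
  induction m using Nat.strong_induction_on with
  | _ m ih =>
  rcases Nat.eq_zero_or_pos m with rfl | hm
  · simp [hU.1]
  have hone : ∀ k, 0 < k → PowerSeries.coeff k (1 : MatSeries n) = 0 := fun k hk => by
    rw [PowerSeries.coeff_one, if_neg hk.ne']
  have key : ∀ μ, PowerSeries.coeff m (B' μ) = PowerSeries.coeff m (B μ) -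
      Complex.I • pdMat μ (PowerSeries.coeff m U) := by
    intro μ
    have hm' := congrArg (PowerSeries.coeff m) (h μ)
    rw [map_sub, PowerSeries.coeff_smul, coeff_pdSeries, PowerSeries.coeff_mul,
      PowerSeries.coeff_mul] at hm'
    rw [Finset.sum_eq_single_of_mem (m, 0) (by simp) ?_,
      Finset.sum_eq_single_of_mem (0, m) (by simp) ?_] at hm'
    · simpa [hU.1] using hm'
    · rintro ⟨p, q⟩ hp hne
      have hp := Finset.HasAntidiagonal.mem_antidiagonal.mp hp
      rcases Nat.eq_zero_or_pos q with rfl | hq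
      · rw [hB0, mul_zero]
      have hpos : 0 < p := by
        rcases Nat.eq_zero_or_pos p with rfl | h'
        · exact absurd (by simpa using hp) (fun h : q = m => hne (by rw [h]))
        · exact h'
      rw [ih p (by simp at hp; omega), hone p hpos, zero_mul]
    · rintro ⟨p, q⟩ hp hne
      have hp := Finset.HasAntidiagonal.mem_antidiagonal.mp hp
      rcases Nat.eq_zero_or_pos p with rfl | hq
      · rw [hB0', zero_mul]
      have hpos : 0 < q := by
        rcases Nat.eq_zero_or_pos q with rfl | h'
        · exact absurd (by simpa using hp) (fun h : p = m => hne (by rw [h]))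
        · exact h'
      rw [ih q (by simp at hp; omega), hone q hpos, mul_zero]
  have hUm : PowerSeries.coeff m U ∈ rapidMat D n := by
    have := (hU.2 m).2
    rwa [map_sub, hone m hm, sub_zero] at this
  have hc := congrArg (PowerSeries.coeff m) hs
  have hc' := congrArg (PowerSeries.coeff m) hs'
  rw [coeff_stringSeries, map_zero] at hc hc'
  have e : (fun μ => PowerSeries.coeff m (B' μ)) = (fun μ => PowerSeries.coeff m (B μ)) +
      (-Complex.I) • fun μ => pdMat μ (PowerSeries.coeff m U) := by
    funext μ
    rw [key μ, sub_eq_add_neg, ← neg_smul]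
    rfl
  rw [e, stringMat_add (hB m).2 ((rapidVec D n).smul_mem _ (rapidVec_grad hUm)), hc, zero_add,
    stringMat_smul _ (rapidVec_grad hUm), stringMat_grad hUm, smul_neg, neg_smul, neg_neg,
    smul_eq_zero] at hc'
  rw [hone m hm]
  exact hc'.resolve_left Complex.I_ne_zero

/-- At most one dressing factor solves the dressing equation. -/
lemma dressing_unique {W V W' V' : MatSeries n} (hW : IsUnipotent D W) (hV : IsUnipotent D V)
    (hW' : IsUnipotent D W') (hV' : IsUnipotent D V') (h2 : V * W = 1)
    (h1' : W' * V' = 1) (h2' : V' * W' = 1) {A : Fin 4 → MatSeries n} (hA : IsPotential D ⊤ A)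
    (hs : stringSeries D (dressedForm W V A) = 0)
    (hs' : stringSeries D (dressedForm W' V' A) = 0) : W' = W := by
  -- With V = W⁻¹, the quotient U = W'W⁻¹ is the gauge function relating the two dressed forms.
  have hU : W' * V = 1 := by
    refine eq_one_of_intertwines (hW'.mul hV) (hW.dressedForm_mem hV hA)
      (coeff_zero_dressedForm hV A) (coeff_zero_dressedForm hV' A) hs hs' fun μ => ?_
    have hd : pdSeries μ V' * W' = -(V' * pdSeries μ W') := by
      have := pdSeries_mul hV'.smooth hW'.smooth μ
      rw [h2', pdSeries_one] at this
      exact eq_neg_of_add_eq_zero_left this.symm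
    have e1 : W' * pdSeries μ V' * (W' * V) = -(pdSeries μ W' * V) := by
      calc W' * pdSeries μ V' * (W' * V) = W' * (pdSeries μ V' * W') * V := by noncomm_ring
        _ = -((W' * V') * (pdSeries μ W' * V)) := by rw [hd]; noncomm_ring
        _ = _ := by rw [h1', one_mul]
    have e2 : W' * (PowerSeries.X * A μ) * V' * (W' * V) = W' * (PowerSeries.X * A μ) * V := by
      calc _ = W' * (PowerSeries.X * A μ) * (V' * W') * V := by noncomm_ring
        _ = _ := by rw [h2', mul_one]
    have e3 : W' * V * (W * (PowerSeries.X * A μ) * V) = W' * (PowerSeries.X * A μ) * V := by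
      calc _ = W' * (V * W) * (PowerSeries.X * A μ) * V := by noncomm_ring
        _ = _ := by rw [h2, mul_one]
    have e4 : W' * V * (W * pdSeries μ V) = W' * pdSeries μ V := by
      calc _ = W' * (V * W) * pdSeries μ V := by noncomm_ring
        _ = _ := by rw [h2, mul_one]
    rw [dressedForm, dressedForm, add_mul, mul_add, smul_mul_assoc, mul_smul_comm, e1, e2, e3, e4,
      pdSeries_mul hW'.smooth hV.smooth, smul_add, smul_neg]
    abel
  calc W' = W' * (V * W) := by rw [h2, mul_one]
    _ = W := by rw [← mul_assoc, hU, one_mul]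

/-- Gauge covariance of the dressing equation. -/
lemma dressedForm_gaugeTransform {W V θ η : MatSeries n} (hV : IsUnipotent D V)
    (hθ : IsUnipotent D θ) (hη : IsUnipotent D η) (h1 : θ * η = 1) (h2 : η * θ = 1)
    (A : Fin 4 → MatSeries n) :
    dressedForm (W * θ) (η * V) (gaugeTransform θ A) = dressedForm W V A := by
  funext μ
  rw [dressedForm, X_mul_gaugeTransform hθ h1 h2, dressedForm, dressedForm,
    pdSeries_mul hη.smooth hV.smooth]
  -- Differentiating θη = 1: the inhomogeneous term of A^θ cancels the derivative of θ⁻¹ in (Wθ)⁻¹.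
  have hd : pdSeries μ θ * η + θ * pdSeries μ η = 0 := by
    rw [← pdSeries_mul hθ.smooth hη.smooth, h1, pdSeries_one]
  have e1 : W * θ * (η * (PowerSeries.X * A μ) * θ) * (η * V) = W * (PowerSeries.X * A μ) * V := by
    calc _ = W * (θ * η) * (PowerSeries.X * A μ) * (θ * η) * V := by noncomm_ring
      _ = _ := by rw [h1, mul_one, mul_one]
  have e2 : W * θ * (η * pdSeries μ θ) * (η * V) = W * (pdSeries μ θ * η) * V := by
    calc _ = W * (θ * η) * (pdSeries μ θ * η) * V := by noncomm_ring
      _ = _ := by rw [h1, mul_one]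
  have e3 : W * θ * (pdSeries μ η * V + η * pdSeries μ V) =
      W * (θ * pdSeries μ η) * V + W * pdSeries μ V := by
    calc _ = W * (θ * pdSeries μ η) * V + W * (θ * η) * pdSeries μ V := by noncomm_ring
      _ = _ := by rw [h1, mul_one]
  rw [mul_add, add_mul, mul_smul_comm, smul_mul_assoc, e1, e2, e3, add_assoc, ← smul_add,
    ← add_assoc, ← add_mul, ← mul_add, hd, mul_zero, zero_mul, zero_add]

end Gauge

/-! ### Linear operations on the space of potentials -/

section PotentialSpace

variable {n : Type} [Fintype n] [DecidableEq n] {D : StringDistribution}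
  {𝔤 : Submodule ℝ (Matrix n n ℂ)}

lemma pdSeries_real_smul (r : ℝ) {F : MatSeries n} (hF : F ∈ smoothSeries n) (μ : Fin 4) :
    pdSeries μ (r • F) = r • pdSeries μ F := by
  ext1 m
  rw [coeff_pdSeries, PowerSeries.coeff_smul, PowerSeries.coeff_smul, coeff_pdSeries,
    ← Complex.coe_smul, pdMat_smul _ (hF m), Complex.coe_smul]

/-- Multiplication of potentials by the coupling constant. -/
def mulX : potentials D 𝔤 →ₗ[ℝ] potentials D 𝔤 where
  toFun v := ⟨fun μ => PowerSeries.X * v.1 μ, IsPotential.X_mul v.2⟩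
  map_add' _ _ := Subtype.ext (funext fun _ => mul_add _ _ _)
  map_smul' r _ := Subtype.ext (funext fun _ => mul_smul_comm r _ _)

/-- The linear map `v ↦ ∂ I_c(v)`. -/
def gradString : potentials D 𝔤 →ₗ[ℝ] potentials D 𝔤 where
  toFun v := ⟨fun μ => pdSeries μ (stringSeries D v.1), (IsPotential.string v.2).grad⟩
  map_add' v w := Subtype.ext (funext fun μ => by
    change pdSeries μ (stringSeries D (v.1 + w.1)) = _
    rw [stringSeries_add v.2 w.2,
      pdSeries_add (IsPotential.string v.2).smooth (IsPotential.string w.2).smooth]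
    rfl)
  map_smul' r v := Subtype.ext (funext fun μ => by
    change pdSeries μ (stringSeries D (r • v.1)) = r • pdSeries μ (stringSeries D v.1)
    rw [stringSeries_smul r v.2, pdSeries_real_smul r (IsPotential.string v.2).smooth])

lemma lieAd_add_left (s t v : MatSeries n) : lieAd (s + t) v = lieAd s v + lieAd t v := by
  simp only [lieAd, add_mul, mul_add, ← smul_add]
  congr 1; abel

lemma lieAd_add_right (s v w : MatSeries n) : lieAd s (v + w) = lieAd s v + lieAd s w := by
  simp only [lieAd, add_mul, mul_add, ← smul_add]
  congr 1; abel

lemma lieAd_real_smul_left (r : ℝ) (s v : MatSeries n) : lieAd (r • s) v = r • lieAd s v := by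
  simp only [lieAd, smul_mul_assoc, mul_smul_comm, ← smul_sub, smul_comm r]

lemma lieAd_real_smul_right (r : ℝ) (s v : MatSeries n) : lieAd s (r • v) = r • lieAd s v := by
  simp only [lieAd, smul_mul_assoc, mul_smul_comm, ← smul_sub, smul_comm r]

lemma lieAd_X_mul_left (s v : MatSeries n) :
    lieAd (PowerSeries.X * s) v = PowerSeries.X * lieAd s v := by
  have h : v * PowerSeries.X = PowerSeries.X * v := PowerSeries.X_mul.symm
  simp only [lieAd, mul_smul_comm, mul_sub]
  rw [← mul_assoc v, h, mul_assoc, mul_assoc]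

/-- The bilinear map `(v, w) ↦ ad_{i I_c(v)}(w)`. -/
def adString (h𝔤 : IsCompactLieAlgebra 𝔤) :
    potentials D 𝔤 →ₗ[ℝ] potentials D 𝔤 →ₗ[ℝ] potentials D 𝔤 :=
  LinearMap.mk₂ ℝ
    (fun v w => ⟨fun μ => lieAd (stringSeries D v.1) (w.1 μ),
      IsPotential.lieAd h𝔤 (IsPotential.string v.2) w.2⟩)
    (fun v v' w => Subtype.ext (funext fun μ => by
      change lieAd (stringSeries D (v.1 + v'.1)) (w.1 μ) = _
      rw [stringSeries_add v.2 v'.2, lieAd_add_left]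
      rfl))
    (fun r v w => Subtype.ext (funext fun μ => by
      change lieAd (stringSeries D (r • v.1)) (w.1 μ) = _
      rw [stringSeries_smul r v.2, lieAd_real_smul_left]
      rfl))
    (fun v w w' => Subtype.ext (funext fun μ => lieAd_add_right _ _ _))
    (fun r v w => Subtype.ext (funext fun μ => lieAd_real_smul_right r _ _))

lemma gradString_mulX (v : potentials D 𝔤) : gradString (mulX v) = mulX (gradString v) :=
  Subtype.ext (funext fun μ => by
    change pdSeries μ (stringSeries D fun μ => PowerSeries.X * v.1 μ) = _
    rw [stringSeries_X_mul, pdSeries_X_mul]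
    rfl)

lemma adString_mulX_left (h𝔤 : IsCompactLieAlgebra 𝔤) (v w : potentials D 𝔤) :
    adString h𝔤 (mulX v) w = mulX (adString h𝔤 v w) :=
  Subtype.ext (funext fun μ => by
    change lieAd (stringSeries D fun μ => PowerSeries.X * v.1 μ) (w.1 μ) = _
    rw [stringSeries_X_mul, lieAd_X_mul_left]
    rfl)

lemma adString_mulX_right (h𝔤 : IsCompactLieAlgebra 𝔤) (v w : potentials D 𝔤) :
    adString h𝔤 v (mulX w) = mulX (adString h𝔤 v w) :=
  Subtype.ext (funext fun _ => lieAd_X_mul_right _ _)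

/-- Equality of potentials by bisimulation. -/
lemma potentials_bisim (R : potentials D 𝔤 → potentials D 𝔤 → Prop)
    (h : ∀ x y, R x y → ∃ z x' y', x = z + mulX x' ∧ y = z + mulX y' ∧ R x' y')
    {x y : potentials D 𝔤} (hxy : R x y) : x = y := by
  apply Subtype.ext
  funext μ
  ext1 m
  induction m generalizing x y with
  | zero =>
    obtain ⟨z, x', y', rfl, rfl, -⟩ := h x y hxy
    change PowerSeries.coeff 0 (z.1 μ + PowerSeries.X * x'.1 μ) =
      PowerSeries.coeff 0 (z.1 μ + PowerSeries.X * y'.1 μ)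
    simp
  | succ m ih =>
    obtain ⟨z, x', y', rfl, rfl, h'⟩ := h x y hxy
    change PowerSeries.coeff (m + 1) (z.1 μ + PowerSeries.X * x'.1 μ) =
      PowerSeries.coeff (m + 1) (z.1 μ + PowerSeries.X * y'.1 μ)
    rw [map_add, map_add, PowerSeries.coeff_succ_X_mul, PowerSeries.coeff_succ_X_mul, ih h']

/-! ### Summation of sequences of potentials -/

lemma coeff_sumSeries (F : ℕ → MatSeries n) (m : ℕ) : PowerSeries.coeff m (sumSeries F) =
    ∑ p ∈ Finset.HasAntidiagonal.antidiagonal m, PowerSeries.coeff p.2 (F p.1) :=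
  PowerSeries.coeff_mk _ _

lemma sumSeries_eq_add (F : ℕ → MatSeries n) :
    sumSeries F = F 0 + PowerSeries.X * sumSeries fun k => F (k + 1) := by
  ext1 m
  cases m with
  | zero => simp [coeff_sumSeries]
  | succ m =>
    rw [map_add, PowerSeries.coeff_succ_X_mul, coeff_sumSeries, coeff_sumSeries,
      Finset.Nat.sum_antidiagonal_succ]

lemma isGaugeParameter_sumSeries {F : ℕ → MatSeries n} (h : ∀ k, IsGaugeParameter D 𝔤 (F k)) :
    IsGaugeParameter D 𝔤 (sumSeries F) := fun m => by
  rw [coeff_sumSeries]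
  exact (lieScalars D 𝔤).sum_mem fun p _ => h p.1 p.2

/-- The potential `∑_k g^k a_k`. -/
def sumPot (a : ℕ → potentials D 𝔤) : potentials D 𝔤 :=
  ⟨fun μ => sumSeries fun k => (a k).1 μ, fun m => by
    simp only [coeff_sumSeries]
    exact lieVectors_sum fun p _ => (a p.1).2 p.2⟩

lemma sumPot_eq_add (a : ℕ → potentials D 𝔤) :
    sumPot a = a 0 + mulX (sumPot fun k => a (k + 1)) :=
  Subtype.ext (funext fun μ => sumSeries_eq_add fun k => (a k).1 μ)

/-- The rules for `sumPot` are proved coinductively: after splitting off the lowest summands, g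
times the same identity for other sequences remains. -/
lemma sumPot_add (a b : ℕ → potentials D 𝔤) : sumPot (a + b) = sumPot a + sumPot b := by
  refine potentials_bisim (fun x y => ∃ a b : ℕ → potentials D 𝔤,
    x = sumPot (a + b) ∧ y = sumPot a + sumPot b) ?_ ⟨a, b, rfl, rfl⟩
  rintro _ _ ⟨a, b, rfl, rfl⟩
  refine ⟨a 0 + b 0, _, _, sumPot_eq_add _, ?_, fun k => a (k + 1), fun k => b (k + 1), rfl, rfl⟩
  rw [sumPot_eq_add a, sumPot_eq_add b, map_add]
  abel

/-- Commuting with multiplication by g takes the place of continuity in the interchange of φ with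
the infinite sum. -/
lemma map_sumPot (φ : potentials D 𝔤 →ₗ[ℝ] potentials D 𝔤)
    (hφ : ∀ v, φ (mulX v) = mulX (φ v)) (a : ℕ → potentials D 𝔤) :
    φ (sumPot a) = sumPot fun k => φ (a k) := by
  refine potentials_bisim (fun x y => ∃ a : ℕ → potentials D 𝔤,
    x = φ (sumPot a) ∧ y = sumPot fun k => φ (a k)) ?_ ⟨a, rfl, rfl⟩
  rintro _ _ ⟨a, rfl, rfl⟩
  refine ⟨φ (a 0), _, _, ?_, sumPot_eq_add _, fun k => a (k + 1), rfl, rfl⟩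
  rw [sumPot_eq_add a, map_add, hφ]

lemma sumPot_sumPot (f : ℕ → ℕ → potentials D 𝔤) :
    sumPot (fun j => sumPot (f j)) =
      sumPot fun m => ∑ p ∈ Finset.HasAntidiagonal.antidiagonal m, f p.1 p.2 := by
  refine potentials_bisim (fun x y => ∃ f : ℕ → ℕ → potentials D 𝔤,
    x = sumPot (fun j => sumPot (f j)) ∧
      y = sumPot fun m => ∑ p ∈ Finset.HasAntidiagonal.antidiagonal m, f p.1 p.2)
    ?_ ⟨f, rfl, rfl⟩
  rintro _ _ ⟨f, rfl, rfl⟩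
  refine ⟨sumPot (f 0), _, _, sumPot_eq_add _, ?_, fun j => f (j + 1), rfl, rfl⟩
  rw [sumPot_eq_add]
  simp only [Finset.Nat.sum_antidiagonal_succ, Finset.Nat.antidiagonal_zero, Finset.sum_singleton]
  have h := sumPot_add (fun k => f 0 (k + 1))
    fun m => ∑ p ∈ Finset.HasAntidiagonal.antidiagonal m, f (p.1 + 1) p.2
  rw [sumPot_eq_add (f 0), add_assoc, ← map_add]
  exact congrArg (fun z => f 0 0 + mulX z) h

lemma adString_sumPot (h𝔤 : IsCompactLieAlgebra 𝔤) (a b : ℕ → potentials D 𝔤) :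
    adString h𝔤 (sumPot a) (sumPot b) =
      sumPot fun m => ∑ p ∈ Finset.HasAntidiagonal.antidiagonal m,
        adString h𝔤 (a p.1) (b p.2) := by
  rw [← sumPot_sumPot (fun j k => adString h𝔤 (a j) (b k))]
  have h1 := map_sumPot ((adString h𝔤).flip (sumPot b))
    (fun v => adString_mulX_left h𝔤 v (sumPot b)) a
  rw [LinearMap.flip_apply] at h1
  rw [h1]
  congr 1
  funext j
  exact map_sumPot (adString h𝔤 (a j)) (adString_mulX_right h𝔤 (a j)) b

/-- Resummation of a series of sums whose `k`-th term starts at order `g^k`. -/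
lemma sum_coeff_sumPot (c : ℕ → ℝ) (x : ℕ → ℕ → potentials D 𝔤)
    (hx : ∀ k j, j < k → x k j = 0) (μ : Fin 4) (m : ℕ) :
    ∑ k ∈ Finset.range (m + 1), c k • PowerSeries.coeff m ((sumPot (x k)).1 μ) =
      PowerSeries.coeff m
        ((sumPot fun j => ∑ k ∈ Finset.range (j + 1), c k • x k j).1 μ) := by
  simp only [sumPot, coeff_sumSeries, Finset.smul_sum]
  rw [Finset.sum_comm]
  refine Finset.sum_congr rfl fun p hp => ?_
  have hp := Finset.HasAntidiagonal.mem_antidiagonal.mp hp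
  rw [Submodule.coe_sum, Finset.sum_apply, map_sum]
  have hsub : Finset.range (p.1 + 1) ⊆ Finset.range (m + 1) :=
    Finset.range_subset_range.mpr (by omega)
  refine (Finset.sum_subset hsub fun k _ hk => ?_).symm
  rw [hx k p.1 (by simpa using hk)]
  change c k • PowerSeries.coeff p.2 (0 : MatSeries n) = 0
  rw [map_zero, smul_zero]

end PotentialSpace

/-! ### Expressions for fields -/

/-- Expressions for vector fields built from the potential `A`, with scalar fields entering only
as string integrals `I_c(u)` of vector fields. -/
inductive FieldExpr : Type
  | zero : FieldExpr
  | pot : FieldExpr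
  | add : FieldExpr → FieldExpr → FieldExpr
  | smul : ℝ → FieldExpr → FieldExpr
  /-- `ad_{i I_c(u)}(v)` -/
  | ad : FieldExpr → FieldExpr → FieldExpr
  /-- `∂ I_c(u)` -/
  | grad : FieldExpr → FieldExpr

namespace FieldExpr

/-- The derivative of a field in the direction of the vector field `v`. -/
def dir (v : FieldExpr) : FieldExpr → FieldExpr
  | zero => zero
  | pot => v
  | add e f => add (dir v e) (dir v f)
  | smul r e => smul r (dir v e)
  | ad e f => add (ad e (dir v f)) (ad (dir v e) f)
  | grad e => grad (dir v e)

/-- Finite sums of expressions. -/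
def esum (f : ℕ → FieldExpr) : ℕ → FieldExpr
  | 0 => zero
  | m + 1 => add (esum f m) (f m)

lemma esum_congr {f f' : ℕ → FieldExpr} {m : ℕ} (h : ∀ k < m, f k = f' k) :
    esum f m = esum f' m := by
  induction m with
  | zero => rfl
  | succ m ih => rw [esum, esum, ih fun k hk => h k (by omega), h m (by omega)]

/-! ### Causal recursions for sequences of expressions -/

/-- The coefficients of `g (∑ g^p a_p) (∑ g^q x_q)`, for the product `op`. -/
def seqOp (op : FieldExpr → FieldExpr → FieldExpr) (a x : ℕ → FieldExpr) (m : ℕ) : FieldExpr :=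
  esum (fun p => op (a p) (x (m - 1 - p))) m

/-- Because of the explicit factor g, order m sees both sequences only below m; in particular order
0 is the empty sum. -/
lemma seqOp_congr (op : FieldExpr → FieldExpr → FieldExpr) {a a' x x' : ℕ → FieldExpr} {m : ℕ}
    (ha : ∀ p < m, a p = a' p) (hx : ∀ p < m, x p = x' p) : seqOp op a x m = seqOp op a' x' m :=
  esum_congr fun k hk => by rw [ha k hk, hx _ (by omega)]

lemma seqOp_iterate_congr (op : FieldExpr → FieldExpr → FieldExpr) {a a' x x' : ℕ → FieldExpr}
    {m : ℕ} (ha : ∀ p < m, a p = a' p) (hx : ∀ p ≤ m, x p = x' p) (k : ℕ) :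
    ∀ l ≤ m, (seqOp op a)^[k] x l = (seqOp op a')^[k] x' l := by
  induction k with
  | zero => exact hx
  | succ k ih =>
    intro l hl
    rw [Function.iterate_succ_apply', Function.iterate_succ_apply']
    exact seqOp_congr op (fun p hp => ha p (by omega)) fun p hp => ih p (by omega)

lemma seqOp_iterate_succ_congr (op : FieldExpr → FieldExpr → FieldExpr)
    {a a' x x' : ℕ → FieldExpr} {m : ℕ} (ha : ∀ p < m, a p = a' p) (hx : ∀ p < m, x p = x' p)
    (k : ℕ) : (seqOp op a)^[k + 1] x m = (seqOp op a')^[k + 1] x' m := by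
  rw [Function.iterate_succ_apply, Function.iterate_succ_apply]
  exact seqOp_iterate_congr op ha (fun p hp => seqOp_congr op (fun q hq => ha q (by omega))
    fun q hq => hx q (by omega)) k m le_rfl

/-- In the outermost derivation, a_m could only be paired with order 0 of the inner k + 1
derivations, which is `zero`. So at order m + 1 only the a_p with p < m enter, which makes the
recursion for the generator causal. -/
lemma seqOp_dir_iterate_congr {a a' x : ℕ → FieldExpr} {m : ℕ} (ha : ∀ p < m, a p = a' p)
    (k : ℕ) : (seqOp dir a)^[k + 2] x (m + 1) = (seqOp dir a')^[k + 2] x (m + 1) := by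
  rw [Function.iterate_succ_apply', Function.iterate_succ_apply' _ (k + 1)]
  refine esum_congr fun p hp => ?_
  rcases Nat.lt_or_ge p m with h | h
  · rw [ha p h, seqOp_iterate_congr dir ha (fun _ _ => rfl) (k + 1) _ (by omega)]
  · obtain rfl : p = m := by omega
    have h0 : ∀ b : ℕ → FieldExpr, (seqOp dir b)^[k + 1] x (p + 1 - 1 - p) = zero := by
      intro b
      rw [show p + 1 - 1 - p = 0 by omega, Function.iterate_succ_apply']
      rfl
    rw [h0, h0]
    rfl

/-- Strong recursion, with the entries not yet defined replaced by z. Causality of the rule is what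
later allows this cutoff to be removed. -/
lemma exists_causal {M : Type*} (z : M) (F : (ℕ → M) → ℕ → M) :
    ∃ s : ℕ → M, ∀ m, s m = F (fun j => if j < m then s j else z) m := by
  classical
  let G : (m : ℕ) → ((j : ℕ) → j < m → M) → M := fun m r =>
    F (fun j => if h : j < m then r j h else z) m
  refine ⟨fun m => Nat.strongRec (motive := fun _ => M) G m, fun m => ?_⟩
  change Nat.strongRec (motive := fun _ => M) G m = _
  rw [Nat.strongRec_eq]
  simp only [G, dite_eq_ite]

end FieldExpr

/-! ### Evaluation of field expressions -/

section Eval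

variable {n : Type} [Fintype n] [DecidableEq n] {D : StringDistribution}
  {𝔤 : Submodule ℝ (Matrix n n ℂ)} (h𝔤 : IsCompactLieAlgebra 𝔤)

namespace FieldExpr

/-- The value of a field expression at a potential. -/
def eval (A : potentials D 𝔤) : FieldExpr → potentials D 𝔤
  | zero => 0
  | pot => A
  | add e f => eval A e + eval A f
  | smul r e => r • eval A e
  | ad e f => adString h𝔤 (eval A e) (eval A f)
  | grad e => gradString (eval A e)

/-- The Fréchet derivative of a field expression. -/
def tangent (A : potentials D 𝔤) : FieldExpr → (potentials D 𝔤 →ₗ[ℝ] potentials D 𝔤)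
  | zero => 0
  | pot => LinearMap.id
  | add e f => tangent A e + tangent A f
  | smul r e => r • tangent A e
  | ad e f => (adString h𝔤 (eval h𝔤 A e)).comp (tangent A f) +
      ((adString h𝔤).flip (eval h𝔤 A f)).comp (tangent A e)
  | grad e => gradString.comp (tangent A e)

/-- The coefficient of `ε^k` of a field expression at `A + ε B`. -/
def taylor (A B : potentials D 𝔤) : FieldExpr → ℕ → potentials D 𝔤
  | zero => fun _ => 0
  | pot => fun k => if k = 0 then A else if k = 1 then B else 0
  | add e f => fun k => taylor A B e k + taylor A B f k
  | smul r e => fun k => r • taylor A B e k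
  | ad e f => fun k => ∑ p ∈ Finset.HasAntidiagonal.antidiagonal k,
      adString h𝔤 (taylor A B e p.1) (taylor A B f p.2)
  | grad e => fun k => gradString (taylor A B e k)

/-- The number of occurrences of the potential. -/
def degree : FieldExpr → ℕ
  | zero => 0
  | pot => 1
  | add e f => degree e + degree f
  | smul _ e => degree e
  | ad e f => degree e + degree f
  | grad e => degree e

lemma tangent_mulX (A B : potentials D 𝔤) (e : FieldExpr) :
    tangent h𝔤 A e (mulX B) = mulX (tangent h𝔤 A e B) := by
  induction e with
  | zero => simp [tangent]
  | pot => rfl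
  | add e f he hf => simp [tangent, he, hf]
  | smul r e he => simp [tangent, he]
  | ad e f he hf => simp [tangent, he, hf, adString_mulX_left, adString_mulX_right]
  | grad e he => simp [tangent, he, gradString_mulX]

/-- Links the two forms of the derivative: `tangent` accepts any direction, while `dir` yields an
expression that can be differentiated again. -/
lemma tangent_eval (A : potentials D 𝔤) (v e : FieldExpr) :
    tangent h𝔤 A e (eval h𝔤 A v) = eval h𝔤 A (dir v e) := by
  induction e with
  | zero => rfl
  | pot => rfl
  | add e f he hf => simp [tangent, dir, eval, he, hf]
  | smul r e he => simp [tangent, dir, eval, he]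
  | ad e f he hf => simp [tangent, dir, eval, he, hf]
  | grad e he => simp [tangent, dir, eval, he]

lemma taylor_zero (A B : potentials D 𝔤) (e : FieldExpr) :
    taylor h𝔤 A B e 0 = eval h𝔤 A e := by
  induction e with
  | zero => rfl
  | pot => rfl
  | add e f he hf => simp [taylor, eval, he, hf]
  | smul r e he => simp [taylor, eval, he]
  | ad e f he hf => simp [taylor, eval, he, hf]
  | grad e he => simp [taylor, eval, he]

lemma taylor_one (A B : potentials D 𝔤) (e : FieldExpr) :
    taylor h𝔤 A B e 1 = tangent h𝔤 A e B := by
  induction e with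
  | zero => rfl
  | pot => rfl
  | add e f he hf => simp [taylor, tangent, he, hf]
  | smul r e he => simp [taylor, tangent, he]
  | ad e f he hf =>
    simp [taylor, tangent, he, hf, Finset.Nat.antidiagonal_succ, taylor_zero]
  | grad e he => simp [taylor, tangent, he]

lemma taylor_eq_zero (A B : potentials D 𝔤) (e : FieldExpr) :
    ∀ k, degree e < k → taylor h𝔤 A B e k = 0 := by
  induction e with
  | zero => intro k _; rfl
  | pot =>
    intro k hk
    simp only [degree] at hk
    simp only [taylor]
    rw [if_neg (by omega), if_neg (by omega)]
  | add e f he hf =>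
    intro k hk
    simp only [degree] at hk
    simp only [taylor]
    rw [he k (by omega), hf k (by omega), add_zero]
  | smul r e he =>
    intro k hk
    simp only [taylor, he k hk, smul_zero]
  | ad e f he hf =>
    intro k hk
    simp only [degree] at hk
    refine Finset.sum_eq_zero fun p hp => ?_
    have hp := Finset.HasAntidiagonal.mem_antidiagonal.mp hp
    rcases Nat.lt_or_ge (degree e) p.1 with h | h
    · rw [he _ h, map_zero, LinearMap.zero_apply]
    · rw [hf _ (by omega), map_zero]
  | grad e he =>
    intro k hk
    simp only [taylor, he k hk, map_zero]

/-- Expressions are polynomial in A, so the Taylor expansion is finite and exact. The number of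
occurrences of A is a generous bound on the degree; only finiteness matters. -/
lemma eval_add_smul (A B : potentials D 𝔤) (ε : ℝ) (e : FieldExpr) :
    ∀ N, degree e < N → eval h𝔤 (A + ε • B) e =
      ∑ k ∈ Finset.range N, ε ^ k • taylor h𝔤 A B e k := by
  induction e with
  | zero => intro N _; simp [eval, taylor]
  | pot =>
    intro N hN
    simp only [degree] at hN
    obtain ⟨N, rfl⟩ := Nat.exists_eq_add_of_le' hN
    rw [Finset.sum_range_succ', Finset.sum_range_succ', Finset.sum_eq_zero]
    · simp [eval, taylor, add_comm]
    · intro k _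
      simp [taylor]
  | add e f he hf =>
    intro N hN
    simp only [degree] at hN
    simp only [eval, taylor, smul_add, Finset.sum_add_distrib]
    rw [he N (by omega), hf N (by omega)]
  | smul r e he =>
    intro N hN
    simp only [eval, taylor, smul_comm _ r, ← Finset.smul_sum]
    rw [he N hN]
  | ad e f he hf =>
    intro N hN
    simp only [degree] at hN
    simp only [eval, taylor, Finset.smul_sum]
    rw [he N (by omega), hf N (by omega)]
    have h := sum_range_range_eq_sum_antidiagonal (fun i j =>
      ε ^ (i + j) • adString h𝔤 (taylor h𝔤 A B e i) (taylor h𝔤 A B f j)) N (fun i j hij => by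
        rcases Nat.lt_or_ge (degree e) i with h | h
        · rw [taylor_eq_zero h𝔤 A B e _ h, map_zero, LinearMap.zero_apply, smul_zero]
        · rw [taylor_eq_zero h𝔤 A B f j (by omega), map_zero, smul_zero])
    have hR : ∀ k, ∑ p ∈ Finset.HasAntidiagonal.antidiagonal k,
        ε ^ k • adString h𝔤 (taylor h𝔤 A B e p.1) (taylor h𝔤 A B f p.2) =
        ∑ p ∈ Finset.HasAntidiagonal.antidiagonal k,
          ε ^ (p.1 + p.2) • adString h𝔤 (taylor h𝔤 A B e p.1) (taylor h𝔤 A B f p.2) :=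
      fun k => Finset.sum_congr rfl fun p hp => by
        rw [Finset.HasAntidiagonal.mem_antidiagonal.mp hp]
    rw [Finset.sum_congr rfl fun k _ => hR k, ← h]
    simp only [map_sum, LinearMap.sum_apply, map_smul, LinearMap.smul_apply, pow_add, mul_smul,
      Finset.smul_sum]
    rw [Finset.sum_comm]
    refine Finset.sum_congr rfl fun i _ => Finset.sum_congr rfl fun j _ => ?_
    rw [smul_comm]
  | grad e he =>
    intro N hN
    simp only [eval, taylor, he N hN, map_sum, map_smul]

end FieldExpr

open FieldExpr

/-! ### Entrywise derivatives of evaluated expressions -/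

/-- The matrix entries of the coefficients of a potential at a point. -/
def entry (m : ℕ) (μ : Fin 4) (x : Spacetime) (i j : n) : potentials D 𝔤 →ₗ[ℝ] ℂ where
  toFun v := PowerSeries.coeff m (v.1 μ) x i j
  map_add' _ _ := rfl
  map_smul' _ _ := rfl

lemma potentials_ext {v w : potentials D 𝔤}
    (h : ∀ m μ x i j, entry m μ x i j v = entry m μ x i j w) : v = w := by
  apply Subtype.ext
  funext μ
  ext1 m
  funext x
  ext i j
  exact h m μ x i j

lemma entry_sumPot (a : ℕ → potentials D 𝔤) (m : ℕ) (μ : Fin 4) (x : Spacetime) (i j : n) :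
    entry m μ x i j (sumPot a) =
      ∑ p ∈ Finset.HasAntidiagonal.antidiagonal m, entry p.2 μ x i j (a p.1) := by
  change PowerSeries.coeff m (sumSeries fun k => (a k).1 μ) x i j = _
  rw [coeff_sumSeries, Finset.sum_apply, Matrix.sum_apply]
  rfl

lemma hasDerivAt_entry_eval (A B : potentials D 𝔤) (e : FieldExpr) (m : ℕ) (μ : Fin 4)
    (x : Spacetime) (i j : n) :
    HasDerivAt (fun ε : ℝ => entry m μ x i j (eval h𝔤 (A + ε • B) e))
      (entry m μ x i j (tangent h𝔤 A e B)) 0 := by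
  have hN : degree e < degree e + 2 := by omega
  simp only [eval_add_smul h𝔤 A B _ e _ hN, map_sum, map_smul]
  have h := HasDerivAt.fun_sum (u := Finset.range (degree e + 2)) fun k _ =>
    (hasDerivAt_pow k (0 : ℝ)).smul_const (entry m μ x i j (taylor h𝔤 A B e k))
  -- At ε = 0 only the linear term of the polynomial has a nonzero derivative.
  rw [Finset.sum_eq_single_of_mem 1 (by simp)] at h
  · simpa [taylor_one] using h
  · intro k _ hk
    rcases Nat.eq_zero_or_pos k with rfl | hpos
    · simp
    · rw [zero_pow (by omega), mul_zero, zero_smul]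

/-- An expression may vanish in value without being `zero`. Since `tangent` computes an actual
derivative, it respects vanishing values, and through `tangent_eval` so does `dir`. -/
lemma tangent_eq_zero {e : FieldExpr} (he : ∀ A : potentials D 𝔤, eval h𝔤 A e = 0)
    (A B : potentials D 𝔤) : tangent h𝔤 A e B = 0 := by
  refine potentials_ext fun m μ x i j => ?_
  have h := hasDerivAt_entry_eval h𝔤 A B e m μ x i j
  simp only [he, map_zero] at h
  rw [map_zero]
  exact h.unique (hasDerivAt_const _ _)

/-! ### Evaluation of products of sequences, and the obstruction map -/

lemma eval_esum (A : potentials D 𝔤) (f : ℕ → FieldExpr) (m : ℕ) :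
    eval h𝔤 A (esum f m) = ∑ k ∈ Finset.range m, eval h𝔤 A (f k) := by
  induction m with
  | zero => rfl
  | succ m ih => rw [Finset.sum_range_succ, ← ih]; rfl

lemma eval_seqOp_succ (A : potentials D 𝔤) (op : FieldExpr → FieldExpr → FieldExpr)
    (a x : ℕ → FieldExpr) (m : ℕ) : eval h𝔤 A (seqOp op a x (m + 1)) =
      ∑ p ∈ Finset.HasAntidiagonal.antidiagonal m, eval h𝔤 A (op (a p.1) (x p.2)) := by
  rw [seqOp, eval_esum, Finset.Nat.sum_antidiagonal_eq_sum_range_succ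
    (fun p q => eval h𝔤 A (op (a p) (x q)))]
  rfl

lemma sumPot_seqOp (A : potentials D 𝔤) (op : FieldExpr → FieldExpr → FieldExpr)
    (a x : ℕ → FieldExpr) : sumPot (fun m => eval h𝔤 A (seqOp op a x m)) =
      mulX (sumPot fun m => ∑ p ∈ Finset.HasAntidiagonal.antidiagonal m,
        eval h𝔤 A (op (a p.1) (x p.2))) := by
  rw [sumPot_eq_add]
  simp only [eval_seqOp_succ]
  exact zero_add _

lemma sumPot_seqOp_ad (A : potentials D 𝔤) (a x : ℕ → FieldExpr) :
    sumPot (fun m => eval h𝔤 A (seqOp ad a x m)) =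
      mulX (adString h𝔤 (sumPot fun k => eval h𝔤 A (a k)) (sumPot fun k => eval h𝔤 A (x k))) := by
  rw [sumPot_seqOp, adString_sumPot]
  rfl

/-- Each application of `seqOp` raises the order by one. This makes the exponential series finite in
every order of g. -/
lemma eval_seqOp_iterate_eq_zero (op : FieldExpr → FieldExpr → FieldExpr)
    (hop : ∀ u z, (∀ A : potentials D 𝔤, eval h𝔤 A z = 0) →
      ∀ A : potentials D 𝔤, eval h𝔤 A (op u z) = 0) (a x : ℕ → FieldExpr) (k : ℕ) :
    ∀ j < k, ∀ A : potentials D 𝔤, eval h𝔤 A ((seqOp op a)^[k] x j) = 0 := by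
  induction k with
  | zero => intro j hj; omega
  | succ k ih =>
    intro j hj A
    rw [Function.iterate_succ_apply', seqOp, eval_esum]
    refine Finset.sum_eq_zero fun p hp => hop _ _ (ih _ ?_) A
    have := Finset.mem_range.mp hp
    omega

lemma eval_dir_eq_zero (u z : FieldExpr) (hz : ∀ A : potentials D 𝔤, eval h𝔤 A z = 0)
    (A : potentials D 𝔤) : eval h𝔤 A (dir u z) = 0 := by
  rw [← tangent_eval, tangent_eq_zero h𝔤 hz]

lemma eval_ad_eq_zero (u z : FieldExpr) (hz : ∀ A : potentials D 𝔤, eval h𝔤 A z = 0)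
    (A : potentials D 𝔤) : eval h𝔤 A (ad u z) = 0 := by
  rw [eval, hz, map_zero]

/-- The obstruction map on power series of fields. -/
lemma obstruction_sumPot {α X : VectorField n} {a x : ℕ → FieldExpr}
    (hα : ∀ A : potentials D 𝔤, α A.1 = (mulX (sumPot fun k => eval h𝔤 A (a k))).1)
    (hX : ∀ A : potentials D 𝔤, X A.1 = (sumPot fun k => eval h𝔤 A (x k)).1)
    (A : potentials D 𝔤) :
    obstruction α X A.1 = (sumPot fun k => eval h𝔤 A (seqOp dir a x k)).1 := by
  set B : potentials D 𝔤 := mulX (sumPot fun k => eval h𝔤 A (a k)) with hB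
  have hT : sumPot (fun k => tangent h𝔤 A (x k) B) =
      sumPot fun k => eval h𝔤 A (seqOp dir a x k) := by
    have h1 : ∀ k, tangent h𝔤 A (x k) B =
        mulX (sumPot fun j => eval h𝔤 A (dir (a j) (x k))) := fun k => by
      rw [hB, tangent_mulX, map_sumPot _ fun v => tangent_mulX h𝔤 A v (x k)]
      simp only [tangent_eval]
    simp only [h1]
    rw [← map_sumPot mulX (fun _ => rfl), sumPot_sumPot, sumPot_seqOp]
    congr 2
    funext m
    exact (Finset.Nat.sum_antidiagonal_swap
      (f := fun p => eval h𝔤 A (dir (a p.1) (x p.2)))).trans rfl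
  rw [← hT]
  funext μ
  ext1 m
  funext y
  ext i j
  change PowerSeries.coeff m (obstruction α X A.1 μ) y i j =
    entry m μ y i j (sumPot fun k => tangent h𝔤 A (x k) B)
  rw [obstruction, PowerSeries.coeff_mk, entry_sumPot]
  -- A + εB is again a potential, so `hX` applies to it; the direction B stays fixed at its value at
  -- A.
  have hfun : (fun ε : ℝ => PowerSeries.coeff m (X (A.1 + ε • α A.1) μ) y i j) = fun ε : ℝ =>
      ∑ p ∈ Finset.HasAntidiagonal.antidiagonal m,
        entry p.2 μ y i j (eval h𝔤 (A + ε • B) (x p.1)) := by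
    funext ε
    rw [← entry_sumPot (fun k => eval h𝔤 (A + ε • B) (x k)), hα A]
    have := hX (A + ε • B)
    change PowerSeries.coeff m (X (A + ε • B : potentials D 𝔤).1 μ) y i j = _
    rw [this]
    rfl
  change deriv (fun ε : ℝ => PowerSeries.coeff m (X (A.1 + ε • α A.1) μ) y i j) 0 = _
  rw [hfun]
  exact (HasDerivAt.fun_sum fun p _ =>
    hasDerivAt_entry_eval h𝔤 A B (x p.1) p.2 μ y i j).deriv

end Eval

/-! ### Field expressions and the spaces of fields -/

section Fields

open FieldExpr

variable {n : Type} [Fintype n] [DecidableEq n] {D : StringDistribution}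
  {𝔤 : Submodule ℝ (Matrix n n ℂ)}

lemma isPotential_adChain (h𝔤 : IsCompactLieAlgebra 𝔤) {l : List (ScalarField n)} {v : VectorField n}
    {A : Fin 4 → MatSeries n} (hl : ∀ s ∈ l, IsGaugeParameter D 𝔤 (s A))
    (hv : IsPotential D 𝔤 (v A)) : IsPotential D 𝔤 (adChain l v A) := by
  induction l with
  | nil => exact hv
  | cons s l ih =>
    exact (ih fun t ht => hl t (List.mem_cons_of_mem _ ht)).lieAd h𝔤 (hl s List.mem_cons_self)

lemma InS.isGaugeParameter {s : ScalarField n} (hs : InS D s)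
    (h𝔤 : IsCompactLieAlgebra 𝔤) {A : Fin 4 → MatSeries n}
    (hA : IsPotential D 𝔤 A) : IsGaugeParameter D 𝔤 (s A) := by
  induction hs with
  | zero => exact (gaugeParameters D 𝔤).zero_mem
  | add s t _ _ hs ht => exact (gaugeParameters D 𝔤).add_mem hs ht
  | smul r s _ hs => exact (gaugeParameters D 𝔤).smul_mem r hs
  | string_A l _ hl => exact (isPotential_adChain (v := potentialField) h𝔤 hl hA).string
  | string_grad l s₀ _ _ _ hl hs₀ =>
    exact (isPotential_adChain (v := gradField s₀) h𝔤 hl hs₀.grad).string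

lemma InV.isPotential {v : VectorField n} (hv : InV D v)
    (h𝔤 : IsCompactLieAlgebra 𝔤) {A : Fin 4 → MatSeries n}
    (hA : IsPotential D 𝔤 A) : IsPotential D 𝔤 (v A) := by
  induction hv with
  | zero => exact (potentials D 𝔤).zero_mem
  | add v w _ _ hv hw => exact (potentials D 𝔤).add_mem hv hw
  | smul r v _ hv => exact (potentials D 𝔤).smul_mem r hv
  | ad_A l hl =>
    exact isPotential_adChain (v := potentialField) h𝔤
      (fun s hs => (hl s hs).isGaugeParameter h𝔤 hA) hA
  | ad_grad l s₀ hl hs₀ =>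
    exact isPotential_adChain (v := gradField s₀) h𝔤
      (fun s hs => (hl s hs).isGaugeParameter h𝔤 hA) (hs₀.isGaugeParameter h𝔤 hA).grad

lemma InV.adField {s : ScalarField n} (hs : InS D s) {v : VectorField n} (hv : InV D v) :
    InV D (adField s v) := by
  have hcons : ∀ l : List (ScalarField n), (∀ t ∈ l, InS D t) → ∀ t ∈ s :: l, InS D t :=
    fun l hl t ht => (List.mem_cons.mp ht).elim (fun h => h ▸ hs) (hl t)
  induction hv with
  | zero =>
    convert InV.zero (D := D) (n := n) using 1
    funext A μ
    simp [_root_.adField]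
  | add v w _ _ hv hw =>
    convert InV.add _ _ hv hw using 1
    funext A μ
    exact lieAd_add_right _ _ _
  | smul r v _ hv =>
    convert InV.smul r _ hv using 1
    funext A μ
    exact lieAd_real_smul_right _ _ _
  | ad_A l hl => exact InV.ad_A (s :: l) (hcons l hl)
  | ad_grad l s₀ hl hs₀ => exact InV.ad_grad (s :: l) s₀ (hcons l hl) hs₀

/-- String integrals of fields in `𝒱^𝔤` belong to `𝒮^𝔤`. -/
lemma InV.exists_string {v : VectorField n} (hv : InV D v)
    (h𝔤 : IsCompactLieAlgebra 𝔤) :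
    ∃ s, InS D s ∧ ∀ A, IsPotential D 𝔤 A → s A = stringSeries D (v A) := by
  induction hv with
  | zero => exact ⟨0, InS.zero, fun A _ => stringSeries_zero.symm⟩
  | add v w hv hw ihv ihw =>
    obtain ⟨s, hs, hs'⟩ := ihv
    obtain ⟨t, ht, ht'⟩ := ihw
    refine ⟨s + t, InS.add s t hs ht, fun A hA => ?_⟩
    rw [Pi.add_apply, Pi.add_apply, hs' A hA, ht' A hA,
      stringSeries_add (hv.isPotential h𝔤 hA) (hw.isPotential h𝔤 hA)]
  | smul r v hv ihv =>
    obtain ⟨s, hs, hs'⟩ := ihv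
    refine ⟨r • s, InS.smul r s hs, fun A hA => ?_⟩
    rw [Pi.smul_apply, Pi.smul_apply, hs' A hA, stringSeries_smul r (hv.isPotential h𝔤 hA)]
  | ad_A l hl => exact ⟨_, InS.string_A l hl, fun A _ => rfl⟩
  | ad_grad l s₀ hl hs₀ =>
    rcases eq_or_ne l [] with rfl | h
    -- The constructor `string_grad` excludes the empty chain, but there I_c(∂s₀) = -s₀ already
    -- belongs to the space.
    · refine ⟨(-1 : ℝ) • s₀, InS.smul _ _ hs₀, fun A hA => ?_⟩
      have := stringSeries_grad (hs₀.isGaugeParameter h𝔤 hA)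
      rw [Pi.smul_apply, neg_one_smul]
      exact this.symm
    · exact ⟨_, InS.string_grad l s₀ h hl hs₀, fun A _ => rfl⟩

/-- Scalars occur in expressions only as I_c(u), and string integrals of 𝒱^𝔤 lie in 𝒮^𝔤, so `ad` and
`grad` stay inside 𝒱^𝔤. Equality is claimed on potentials only, where I_c is known to be linear. -/
lemma exists_inV_eval (h𝔤 : IsCompactLieAlgebra 𝔤) (e : FieldExpr) :
    ∃ v : VectorField n, InV D v ∧ ∀ A : potentials D 𝔤, v A.1 = (eval h𝔤 A e).1 := by
  induction e with
  | zero => exact ⟨0, InV.zero, fun A => rfl⟩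
  | pot => exact ⟨_, InV.ad_A [] (by simp), fun A => rfl⟩
  | add e f he hf =>
    obtain ⟨v, hv, hv'⟩ := he
    obtain ⟨w, hw, hw'⟩ := hf
    refine ⟨v + w, InV.add v w hv hw, fun A => ?_⟩
    rw [Pi.add_apply, hv', hw']
    rfl
  | smul r e he =>
    obtain ⟨v, hv, hv'⟩ := he
    refine ⟨r • v, InV.smul r v hv, fun A => ?_⟩
    rw [Pi.smul_apply, hv']
    rfl
  | ad e f he hf =>
    obtain ⟨v, hv, hv'⟩ := he
    obtain ⟨w, hw, hw'⟩ := hf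
    obtain ⟨s, hs, hs'⟩ := hv.exists_string h𝔤
    refine ⟨adField s w, hw.adField hs, fun A => ?_⟩
    funext μ
    simp only [adField]
    rw [hs' A.1 A.2, hv', hw']
    rfl
  | grad e he =>
    obtain ⟨v, hv, hv'⟩ := he
    obtain ⟨s, hs, hs'⟩ := hv.exists_string h𝔤
    refine ⟨_, InV.ad_grad [] s (by simp) hs, fun A => ?_⟩
    funext μ
    change pdSeries μ (s A.1) = _
    rw [hs' A.1 A.2, hv']
    rfl

lemma exists_inS_eval (h𝔤 : IsCompactLieAlgebra 𝔤) (e : FieldExpr) :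
    ∃ s : ScalarField n, InS D s ∧
      ∀ A : potentials D 𝔤, s A.1 = stringSeries D (eval h𝔤 A e).1 := by
  obtain ⟨v, hv, hv'⟩ := exists_inV_eval h𝔤 e
  obtain ⟨s, hs, hs'⟩ := hv.exists_string h𝔤
  exact ⟨s, hs, fun A => by rw [hs' A.1 A.2, hv']⟩

end Fields

/-! ### The dressing series -/

section Dressing

open FieldExpr

variable {n : Type} [Fintype n] [DecidableEq n] {D : StringDistribution}
  {𝔤 : Submodule ℝ (Matrix n n ℂ)} (h𝔤 : IsCompactLieAlgebra 𝔤)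

/-- The sequence `(A, 0, 0, …)`. -/
def potSeq : ℕ → FieldExpr
  | 0 => pot
  | _ + 1 => zero

/-- The order `g^l` of `∑_k ad^k(A) / k! + ∑_{k ≥ 1} ad^k(∂ I_c(e)) / (k+1)!`, where
`ad = ad_{i g I_c(e)}`. -/
def dressingStep (e : ℕ → FieldExpr) (l : ℕ) : FieldExpr :=
  add (esum (fun k => smul ((k.factorial : ℝ)⁻¹) ((seqOp ad e)^[k] potSeq l)) (l + 1))
    (esum (fun k => smul (((k + 2).factorial : ℝ)⁻¹)
      ((seqOp ad e)^[k + 1] (fun j => grad (e j)) l)) l)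

/-- The only non-causal term, ∂I_c(e_l) with no commutator, is absent from `dressingStep`; each
remaining occurrence of the unknown sits under a commutator carrying a factor g. -/
lemma exists_dressingSeq : ∃ e : ℕ → FieldExpr, ∀ l, e l = dressingStep e l := by
  obtain ⟨e, he⟩ := exists_causal zero dressingStep
  refine ⟨e, fun l => (he l).trans ?_⟩
  have htr : ∀ p < l, (if p < l then e p else zero) = e p := fun p hp => if_pos hp
  simp only [dressingStep]
  congr 1
  · refine esum_congr fun k _ => congrArg _ ?_
    exact seqOp_iterate_congr ad htr (fun _ _ => rfl) k l le_rfl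
  · refine esum_congr fun k _ => congrArg _ ?_
    exact seqOp_iterate_succ_congr ad htr (fun p hp => congrArg FieldExpr.grad (htr p hp)) k

/-- The order `g^{l+1}` of the generator whose flow maps `A` to `∑ g^k e_k`. -/
def generatorStep (e a : ℕ → FieldExpr) (l : ℕ) : FieldExpr :=
  add (e (l + 1)) (smul (-1) (esum (fun k => smul (((k + 2).factorial : ℝ)⁻¹)
    ((seqOp dir a)^[k + 2] potSeq (l + 1))) l))

lemma exists_generatorSeq (e : ℕ → FieldExpr) :
    ∃ a : ℕ → FieldExpr, ∀ l, a l = generatorStep e a l := by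
  obtain ⟨a, ha⟩ := exists_causal zero (generatorStep e)
  refine ⟨a, fun l => (ha l).trans ?_⟩
  have htr : ∀ p < l, (if p < l then a p else zero) = a p := fun p hp => if_pos hp
  simp only [generatorStep]
  congr 2
  exact esum_congr fun k _ => congrArg _ (seqOp_dir_iterate_congr htr k)

lemma sumPot_zero : sumPot (fun _ => (0 : potentials D 𝔤)) = 0 :=
  (map_sumPot (0 : potentials D 𝔤 →ₗ[ℝ] potentials D 𝔤) (fun _ => by simp) fun _ => 0).symm

lemma sumPot_potSeq (A : potentials D 𝔤) : sumPot (fun k => eval h𝔤 A (potSeq k)) = A := by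
  rw [sumPot_eq_add]
  have h : (fun k => eval h𝔤 A (potSeq (k + 1))) = fun _ => 0 := rfl
  rw [h, sumPot_zero, map_zero, add_zero]
  rfl

/-! ### The string projection, the dressing series and its generator -/

/-- The projection `v ↦ v + ∂ I_c(v)` onto the kernel of string integration. -/
def stringProj : potentials D 𝔤 →ₗ[ℝ] potentials D 𝔤 := LinearMap.id + gradString

lemma stringProj_mulX (v : potentials D 𝔤) : stringProj (mulX v) = mulX (stringProj v) := by
  simp [stringProj, gradString_mulX]

lemma stringSeries_stringProj (v : potentials D 𝔤) :
    stringSeries D (stringProj v).1 = 0 := by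
  change stringSeries D (v.1 + (gradString v).1) = 0
  rw [stringSeries_add v.2 (gradString v).2]
  have := stringSeries_grad (IsPotential.string v.2)
  change _ + stringSeries D (fun μ => pdSeries μ (stringSeries D v.1)) = 0
  rw [this, add_neg_cancel]

/-- In I_c^ν(∂_μ A_ν - ∂_ν A_μ) the derivative ∂_μ moves out of the first integral, and the second
integral is that of a gradient, hence -A_μ. -/
lemma stringPotential_eq (A : potentials D 𝔤) : stringPotential D A.1 = (stringProj A).1 := by
  funext μ
  have h1 : IsPotential D ⊤ fun ν => pdSeries μ (A.1 ν) := fun m =>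
    ⟨fun _ _ => trivial, by
      simp only [coeff_pdSeries]
      exact rapidVec_pd (A.2 m).2 μ⟩
  have hs : IsGaugeParameter D ⊤ (A.1 μ) := fun m =>
    ⟨fun _ => trivial, rapidVec_component (A.2 m).2 μ⟩
  have e : fieldStrength A.1 μ =
      (fun ν => pdSeries μ (A.1 ν)) + (-1 : ℝ) • fun ν => pdSeries ν (A.1 μ) := by
    funext ν
    rw [fieldStrength, neg_one_smul, sub_eq_add_neg]
    rfl
  rw [stringPotential, e, stringSeries_add h1 ((potentials D ⊤).smul_mem _ hs.grad),
    stringSeries_smul _ hs.grad, stringSeries_grad hs, ← pdSeries_stringSeries A.2, neg_one_smul,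
    neg_neg, add_comm]
  rfl

lemma stringSeries_sumPot (a : ℕ → potentials D 𝔤) :
    stringSeries D (sumPot a).1 = sumSeries fun k => stringSeries D (a k).1 := by
  ext1 m
  have hstep : ∀ a : ℕ → potentials D 𝔤, stringSeries D (sumPot a).1 =
      stringSeries D (a 0).1 + PowerSeries.X * stringSeries D (sumPot fun k => a (k + 1)).1 := by
    intro a
    rw [← stringSeries_X_mul, sumPot_eq_add]
    exact stringSeries_add (a 0).2 (mulX _).2
  induction m generalizing a with
  | zero => rw [hstep, sumSeries_eq_add]; simp
  | succ m ih =>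
    rw [hstep, sumSeries_eq_add, map_add, map_add, PowerSeries.coeff_succ_X_mul,
      PowerSeries.coeff_succ_X_mul, ih]

/-- The gauge transform of `A` by `exp(-i g I_c(∑ g^k e_k))` for a dressing series `e`. -/
lemma adExp_dressingSeq {e : ℕ → FieldExpr} (he : ∀ l, e l = dressingStep e l)
    (A : potentials D 𝔤) (μ : Fin 4) :
    adExp (PowerSeries.X * stringSeries D (sumPot fun k => eval h𝔤 A (e k)).1) (A.1 μ)
        (pdSeries μ (stringSeries D (sumPot fun k => eval h𝔤 A (e k)).1)) =
      (stringProj (sumPot fun k => eval h𝔤 A (e k))).1 μ := by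
  set Φ := sumPot fun k => eval h𝔤 A (e k) with hΦ
  have hiter : ∀ (x : ℕ → FieldExpr) (k : ℕ),
      (lieAd (PowerSeries.X * stringSeries D Φ.1))^[k]
        ((sumPot fun j => eval h𝔤 A (x j)).1 μ) =
      (sumPot fun j => eval h𝔤 A ((seqOp ad e)^[k] x j)).1 μ := by
    intro x k
    induction k with
    | zero => rfl
    | succ k ih =>
      rw [Function.iterate_succ_apply', ih, Function.iterate_succ_apply', sumPot_seqOp_ad,
        lieAd_X_mul_left]
      rfl
  have hA := hiter potSeq
  rw [sumPot_potSeq] at hA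
  have hgrad : gradString Φ = sumPot fun j => eval h𝔤 A (grad (e j)) :=
    map_sumPot gradString gradString_mulX _
  have hG := hiter fun j => grad (e j)
  rw [← hgrad] at hG
  have hG' : ∀ k, (lieAd (PowerSeries.X * stringSeries D Φ.1))^[k]
      (pdSeries μ (stringSeries D Φ.1)) = _ := hG
  ext1 m
  simp only [adExp, PowerSeries.coeff_mk, inv_natCast_smul, Finset.sum_add_distrib, hA, hG']
  rw [sum_coeff_sumPot (fun k => ((k.factorial : ℝ)⁻¹)) _
      (fun k j hj => eval_seqOp_iterate_eq_zero h𝔤 ad (eval_ad_eq_zero h𝔤) e _ k j hj A),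
    sum_coeff_sumPot (fun k => (((k + 1).factorial : ℝ)⁻¹)) _
      (fun k j hj => eval_seqOp_iterate_eq_zero h𝔤 ad (eval_ad_eq_zero h𝔤) e _ k j hj A),
    ← map_add]
  change PowerSeries.coeff m ((sumPot _ + sumPot _ : potentials D 𝔤).1 μ) = _
  rw [← sumPot_add, hΦ, map_sumPot stringProj stringProj_mulX]
  refine congrArg (fun f => PowerSeries.coeff m ((sumPot f).1 μ)) (funext fun j => ?_)
  change _ = eval h𝔤 A (e j) + gradString (eval h𝔤 A (e j))
  -- The k = 0 term of the second sum is ∂I_c(e_j), the gradient part of the projection; the rest is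
  -- `dressingStep`.
  rw [Pi.add_apply, Finset.sum_range_succ' (n := j)
    (f := fun k => (((k + 1).factorial : ℝ)⁻¹) • _), ← add_assoc]
  congr 1
  · conv_rhs => rw [he j]
    simp only [dressingStep, eval, eval_esum]
  · simp [eval]

/-- The flow of the generator maps `A` to `∑ g^k e_k`. -/
lemma sum_generatorSeq {e a : ℕ → FieldExpr} (he : ∀ l, e l = dressingStep e l)
    (ha : ∀ l, a l = generatorStep e a l) (A : potentials D 𝔤) (j : ℕ) :
    ∑ k ∈ Finset.range (j + 1), ((k.factorial : ℝ)⁻¹) •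
      eval h𝔤 A ((seqOp dir a)^[k] potSeq j) = eval h𝔤 A (e j) := by
  cases j with
  | zero =>
    rw [he 0]
    simp [dressingStep, eval, esum, potSeq]
  | succ l =>
    -- For k = 0 there is no contribution in order l + 1, and k = 1 contributes a_l, which by
    -- `generatorStep` is e_{l+1} minus the terms with k ≥ 2.
    rw [Finset.sum_range_succ', Finset.sum_range_succ']
    have h0 : eval h𝔤 A ((seqOp dir a)^[0] potSeq (l + 1)) = 0 := rfl
    have h1 : eval h𝔤 A ((seqOp dir a)^[0 + 1] potSeq (l + 1)) = eval h𝔤 A (a l) := by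
      change eval h𝔤 A (seqOp dir a potSeq (l + 1)) = _
      rw [eval_seqOp_succ, Finset.sum_eq_single_of_mem (l, 0) (by simp)]
      · rfl
      · rintro ⟨p, q⟩ hp hne
        have hp := Finset.HasAntidiagonal.mem_antidiagonal.mp hp
        cases q with
        | zero => exact absurd (by simpa using hp) fun h : p = l => hne (by rw [h])
        | succ q => rfl
    rw [h0, h1, ha l]
    simp only [generatorStep, eval, eval_esum, zero_add, Nat.factorial_one, Nat.cast_one, inv_one,
      one_smul, smul_zero, add_zero]
    have hcancel : ∀ x y : potentials D 𝔤, x + (y + (-1 : ℝ) • x) = y := fun x y => by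
      rw [neg_one_smul ℝ x, add_neg_cancel_comm_assoc]
    exact hcancel _ _

/-- The iterated obstruction map on the string-localized potential. -/
lemma obstruction_iterate_stringPotential {α : VectorField n} {a : ℕ → FieldExpr}
    (hα : ∀ A : potentials D 𝔤, α A.1 = (mulX (sumPot fun k => eval h𝔤 A (a k))).1) (k : ℕ)
    (A : potentials D 𝔤) : (obstruction α)^[k] (stringPotential D) A.1 =
      (sumPot fun j => stringProj (eval h𝔤 A ((seqOp dir a)^[k] potSeq j))).1 := by
  induction k generalizing A with
  | zero =>
    rw [← map_sumPot stringProj stringProj_mulX]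
    change stringPotential D A.1 = (stringProj (sumPot fun j => eval h𝔤 A (potSeq j))).1
    rw [sumPot_potSeq, stringPotential_eq]
  | succ k ih =>
    rw [Function.iterate_succ_apply']
    -- The projection is itself written as an expression, and `dir` passes through `add` and `grad`,
    -- so the derivation commutes with it.
    rw [obstruction_sumPot h𝔤 (x := fun j => add ((seqOp dir a)^[k] potSeq j)
      (grad ((seqOp dir a)^[k] potSeq j))) hα ih]
    congr 2
    funext j
    rw [Function.iterate_succ_apply', seqOp, seqOp, eval_esum, eval_esum, map_sum]
    rfl

/-! ### Dressing exponents -/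

lemma IsDressingExponent.exists_parameter {γ : ScalarField n} (hγ : IsDressingExponent D 𝔤 γ)
    (h𝔤 : IsCompactLieAlgebra 𝔤) {A : Fin 4 → MatSeries n} (hA : IsPotential D 𝔤 A) :
    ∃ G, IsGaugeParameter D 𝔤 G ∧ γ A = PowerSeries.X * G := by
  obtain ⟨a, ha, ha0, hsum⟩ := hγ.1
  refine ⟨sumSeries fun k => a (k + 1) A,
    isGaugeParameter_sumSeries fun k => (ha (k + 1)).isGaugeParameter h𝔤 hA, ?_⟩
  rw [hsum A hA, sumSeries_eq_add, ha0, Pi.zero_apply, zero_add]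

/-- Exponentials of gauge parameters are unipotent, with unipotent inverses. -/
lemma IsGaugeParameter.unipotent {G : MatSeries n} (hG : IsGaugeParameter D 𝔤 G) :
    IsUnipotent D (expSeries (Complex.I • (PowerSeries.X * G))) ∧
      IsUnipotent D (expSeries (-(Complex.I • (PowerSeries.X * G)))) := by
  have h := hG.top.X_mul.smul_complex Complex.I
  exact ⟨isUnipotent_expSeries h, isUnipotent_expSeries h.neg⟩

lemma IsDressingExponent.unipotent {γ : ScalarField n} (hγ : IsDressingExponent D 𝔤 γ)
    (h𝔤 : IsCompactLieAlgebra 𝔤) {A : Fin 4 → MatSeries n} (hA : IsPotential D 𝔤 A) :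
    ∃ V, IsUnipotent D (dressingFactor γ A) ∧ IsUnipotent D V ∧ dressingFactor γ A * V = 1 ∧
      V * dressingFactor γ A = 1 ∧ Ring.inverse (dressingFactor γ A) = V ∧
      stringSeries D (dressedForm (dressingFactor γ A) V A) = 0 := by
  obtain ⟨G, hG, hGA⟩ := hγ.exists_parameter h𝔤 hA
  have hu := vanishesBelow_I_smul_X_mul G
  have hW : dressingFactor γ A = expSeries (Complex.I • (PowerSeries.X * G)) := by
    rw [dressingFactor, hGA]
  have hinv : Ring.inverse (dressingFactor γ A) =
      expSeries (-(Complex.I • (PowerSeries.X * G))) := by rw [hW, inverse_expSeries hu]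
  refine ⟨expSeries (-(Complex.I • (PowerSeries.X * G))), hW ▸ hG.unipotent.1, hG.unipotent.2,
    hW ▸ expSeries_mul_neg hu, hW ▸ expSeries_neg_mul hu, hinv, ?_⟩
  rw [← hinv]
  exact hγ.2 A hA

lemma IsDressingExponent.unique {γ γ' : ScalarField n} (hγ : IsDressingExponent D 𝔤 γ)
    (hγ' : IsDressingExponent D 𝔤 γ') (h𝔤 : IsCompactLieAlgebra 𝔤) {A : Fin 4 → MatSeries n}
    (hA : IsPotential D 𝔤 A) : γ' A = γ A := by
  obtain ⟨V, hW, hV, -, h2, -, hs⟩ := hγ.unipotent h𝔤 hA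
  obtain ⟨V', hW', hV', h1', h2', -, hs'⟩ := hγ'.unipotent h𝔤 hA
  have h := dressing_unique hW hV hW' hV' h2 h1' h2' hA.top hs hs'
  obtain ⟨G, -, hG⟩ := hγ.exists_parameter h𝔤 hA
  obtain ⟨G', -, hG'⟩ := hγ'.exists_parameter h𝔤 hA
  rw [dressingFactor, dressingFactor, hG, hG'] at h
  have := expSeries_injective (vanishesBelow_I_smul_X_mul G') (vanishesBelow_I_smul_X_mul G) h
  rw [hG, hG']
  exact smul_right_injective _ Complex.I_ne_zero this

/-- Gauge covariance of the dressing factor and gauge invariance of the dressed potential. -/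
lemma IsDressingExponent.gauge {γ : ScalarField n} (hγ : IsDressingExponent D 𝔤 γ)
    (h𝔤 : IsCompactLieAlgebra 𝔤) {l : MatSeries n} (hl : IsGaugeParameter D 𝔤 l)
    {A : Fin 4 → MatSeries n} (hA : IsPotential D 𝔤 A) :
    dressingFactor γ (gaugeTransform (gaugeFunction l) A) =
        dressingFactor γ A * gaugeFunction l ∧
      dressedPotential γ (gaugeTransform (gaugeFunction l) A) = dressedPotential γ A := by
  have hA' := hA.gaugeTransform h𝔤 hl
  obtain ⟨V, hW, hV, h1, h2, hinv, hs⟩ := hγ.unipotent h𝔤 hA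
  obtain ⟨V', hW', hV', h1', h2', hinv', hs'⟩ := hγ.unipotent h𝔤 hA'
  have hθ : IsUnipotent D (gaugeFunction l) := hl.unipotent.1
  have hη := hl.unipotent.2
  have ht1 : gaugeFunction l * expSeries (-(Complex.I • (PowerSeries.X * l))) = 1 :=
    expSeries_mul_neg (vanishesBelow_I_smul_X_mul l)
  have ht2 : expSeries (-(Complex.I • (PowerSeries.X * l))) * gaugeFunction l = 1 :=
    expSeries_neg_mul (vanishesBelow_I_smul_X_mul l)
  generalize gaugeFunction l = θ at *
  generalize expSeries (-(Complex.I • (PowerSeries.X * l))) = η at *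
  have hcov := dressedForm_gaugeTransform (W := dressingFactor γ A) hV hθ hη ht1 ht2 A
  have hr1 : dressingFactor γ A * θ * (η * V) = 1 := by
    rw [mul_assoc, ← mul_assoc θ, ht1, one_mul, h1]
  have hr2 : η * V * (dressingFactor γ A * θ) = 1 := by
    rw [mul_assoc, ← mul_assoc V, h2, one_mul, ht2]
  -- Both sides solve the dressing equation at the transformed potential.
  have hfac : dressingFactor γ (gaugeTransform θ A) = dressingFactor γ A * θ :=
    dressing_unique (hW.mul hθ) (hη.mul hV) hW' hV' hr2 h1' h2' hA'.top (by rw [hcov, hs]) hs'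
  refine ⟨hfac, ?_⟩
  funext μ
  apply X_mul_cancel
  rw [dressedPotential, dressedPotential, hinv, hfac, inverse_eq_of_mul_eq_one hr1 hr2,
    X_mul_gaugeTransform (hη.mul hV) hr2 hr1, X_mul_gaugeTransform hV h2 h1, hcov]

lemma dressedPotential_of_parameter {γ : ScalarField n} {e : ℕ → FieldExpr}
    (he : ∀ l, e l = dressingStep e l) (A : potentials D 𝔤)
    (hγA : γ A.1 = PowerSeries.X * stringSeries D (sumPot fun k => eval h𝔤 A (e k)).1) :
    dressedPotential γ A.1 = (stringProj (sumPot fun k => eval h𝔤 A (e k))).1 := by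
  funext μ
  rw [dressedPotential, dressingFactor, hγA, inverse_expSeries (vanishesBelow_I_smul_X_mul _),
    gaugeTransform_expSeries_neg (IsPotential.string (sumPot fun k => eval h𝔤 A (e k)).2),
    adExp_dressingSeq h𝔤 he]

/-- A dressing series determines a dressing exponent. -/
lemma exists_isDressingExponent {e : ℕ → FieldExpr} (he : ∀ l, e l = dressingStep e l) :
    ∃ γ : ScalarField n, IsDressingExponent D 𝔤 γ ∧ ∀ A : potentials D 𝔤,
      γ A.1 = PowerSeries.X * stringSeries D (sumPot fun k => eval h𝔤 A (e k)).1 := by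
  classical
  let γ : ScalarField n := fun A => if hA : IsPotential D 𝔤 A then
    PowerSeries.X * stringSeries D (sumPot fun k => eval h𝔤 ⟨A, hA⟩ (e k)).1 else 0
  have hγA : ∀ A : potentials D 𝔤,
      γ A.1 = PowerSeries.X * stringSeries D (sumPot fun k => eval h𝔤 A (e k)).1 :=
    fun A => dif_pos A.2
  refine ⟨γ, ⟨?_, fun A hA => ?_⟩, hγA⟩
  · choose s hs hs' using fun k => exists_inS_eval (D := D) h𝔤 (e k)
    -- The sequence is shifted by one place to account for the overall factor g in γ.
    refine ⟨fun k => Nat.casesOn k 0 s, fun k => ?_, rfl, fun A hA => ?_⟩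
    · cases k with
      | zero => exact InS.zero
      | succ k => exact hs k
    · rw [hγA ⟨A, hA⟩, sumSeries_eq_add, stringSeries_sumPot]
      simp only [fun k => hs' k ⟨A, hA⟩]
      exact (zero_add _).symm
  · have hG := IsPotential.string (sumPot fun k => eval h𝔤 ⟨A, hA⟩ (e k)).2
    have hu := vanishesBelow_I_smul_X_mul
      (stringSeries D (sumPot fun k => eval h𝔤 ⟨A, hA⟩ (e k)).1)
    have hW : dressingFactor γ A = expSeries (Complex.I • (PowerSeries.X *
        stringSeries D (sumPot fun k => eval h𝔤 ⟨A, hA⟩ (e k)).1)) := by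
      rw [dressingFactor, hγA ⟨A, hA⟩]
    have hinv := inverse_expSeries hu
    have hform : ∀ μ, PowerSeries.X * dressedPotential γ A μ =
        dressedForm (dressingFactor γ A) (Ring.inverse (dressingFactor γ A)) A μ := by
      intro μ
      rw [dressedPotential, hW, hinv]
      exact X_mul_gaugeTransform hG.unipotent.2 (expSeries_neg_mul hu) (expSeries_mul_neg hu) A μ
    change stringSeries D
      (fun μ => dressedForm (dressingFactor γ A) (Ring.inverse (dressingFactor γ A)) A μ) = 0
    simp only [← hform]
    rw [stringSeries_X_mul, dressedPotential_of_parameter h𝔤 he ⟨A, hA⟩ (hγA ⟨A, hA⟩),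
      stringSeries_stringProj, mul_zero]

lemma IsDressingExponent.exists_generates {γ : ScalarField n} (hγ : IsDressingExponent D 𝔤 γ)
    (h𝔤 : IsCompactLieAlgebra 𝔤) : ∃ α : VectorField n, GeneratesDressing D 𝔤 γ α := by
  classical
  obtain ⟨e, he⟩ := exists_dressingSeq
  obtain ⟨a, ha⟩ := exists_generatorSeq e
  obtain ⟨γ₀, hγ₀, hγ₀A⟩ := exists_isDressingExponent (D := D) h𝔤 he
  let α : VectorField n := fun A => if hA : IsPotential D 𝔤 A then
    (mulX (sumPot fun k => eval h𝔤 ⟨A, hA⟩ (a k))).1 else 0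
  have hα : ∀ A : potentials D 𝔤, α A.1 = (mulX (sumPot fun k => eval h𝔤 A (a k))).1 :=
    fun A => dif_pos A.2
  refine ⟨α, ?_, fun A hA => ?_⟩
  · choose v hv hv' using fun k => exists_inV_eval (D := D) h𝔤 (a k)
    refine ⟨fun k => Nat.casesOn k 0 v, fun k => ?_, rfl, fun A hA μ => ?_⟩
    · cases k with
      | zero => exact InV.zero
      | succ k => exact hv k
    · rw [hα ⟨A, hA⟩, sumSeries_eq_add]
      simp only [fun k => hv' k ⟨A, hA⟩]
      exact (zero_add _).symm
  -- The generator is built from the explicit exponent γ₀; by uniqueness γ agrees with it on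
  -- potentials.
  · rw [dressedPotential_of_parameter h𝔤 he ⟨A, hA⟩
      ((hγ₀.unique hγ h𝔤 hA).trans (hγ₀A ⟨A, hA⟩))]
    funext μ
    ext1 m
    rw [expObstruction, PowerSeries.coeff_mk]
    simp only [inv_natCast_smul, obstruction_iterate_stringPotential h𝔤 hα _ ⟨A, hA⟩]
    rw [sum_coeff_sumPot (fun k => ((k.factorial : ℝ)⁻¹)) _ (fun k j hj => by
        rw [eval_seqOp_iterate_eq_zero h𝔤 dir (eval_dir_eq_zero h𝔤) a potSeq k j hj, map_zero]),
      map_sumPot stringProj stringProj_mulX]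
    simp only [← map_smul, ← map_sum, sum_generatorSeq h𝔤 he ha]

end Dressing

end

theorem propositionp {n : Type} [Fintype n] [DecidableEq n]
    (𝔤 : Submodule ℝ (Matrix n n ℂ)) (h𝔤 : IsCompactLieAlgebra 𝔤) (D : StringDistribution) :
    (∃ γ : ScalarField n, IsDressingExponent D 𝔤 γ) ∧
    ∀ γ : ScalarField n, IsDressingExponent D 𝔤 γ →
      (∀ γ' : ScalarField n, IsDressingExponent D 𝔤 γ' →
        ∀ A, IsPotential D 𝔤 A → γ' A = γ A) ∧
      (∃ α : VectorField n, GeneratesDressing D 𝔤 γ α) ∧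
      ∀ l : MatSeries n, IsGaugeParameter D 𝔤 l → ∀ A, IsPotential D 𝔤 A →
        IsPotential D 𝔤 (gaugeTransform (gaugeFunction l) A) ∧
        dressingFactor γ (gaugeTransform (gaugeFunction l) A) =
          dressingFactor γ A * gaugeFunction l ∧
        dressedPotential γ (gaugeTransform (gaugeFunction l) A) = dressedPotential γ A ∧
        ∀ α : VectorField n, GeneratesDressing D 𝔤 γ α →
          expObstruction α (stringPotential D) (gaugeTransform (gaugeFunction l) A) =
            expObstruction α (stringPotential D) A := by
  refine ⟨?_, fun γ hγ => ⟨fun γ' hγ' A hA => hγ.unique hγ' h𝔤 hA, hγ.exists_generates h𝔤,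
    fun l hl A hA => ?_⟩⟩
  · obtain ⟨e, he⟩ := exists_dressingSeq
    obtain ⟨γ, hγ, -⟩ := exists_isDressingExponent (D := D) h𝔤 he
    exact ⟨γ, hγ⟩
  · have hA' := hA.gaugeTransform h𝔤 hl
    obtain ⟨hfac, hdress⟩ := hγ.gauge h𝔤 hl hA
    -- Since A and A^θ are both potentials, `hα` replaces both flows by dressed potentials, which
    -- coincide.
    exact ⟨hA', hfac, hdress, fun α hα => by rw [hα.2 _ hA', hα.2 _ hA, hdress]⟩
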